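/- An ontology-mediated query (OMQ) $Q=(\mathcal T,\Sigma,q)$ from $(\mathcal{ELI},\mathrm{CQ})$ consists of an $\mathcal{ELI}$-TBox $\mathcal T$ (a finite set of inclusions $C\sqsubseteq D$ of concepts built from $\top$, concept names, $\sqcap$, $\exists r.C$ and $\exists r^-.C$), a set $\Sigma$ of concept and role names, and a conjunctive query $q$ without equality, possibly disconnected, with $\mathrm{ar}(q)\ge 0$ answer variables. A $\Sigma$-ABox $\mathcal A$ is a finite set of assertions $A(a)$, $r(a,b)$ with $A,r\in\Sigma$; $\mathrm{ind}(\mathcal A)$ is the set of individuals occurring in it, and $\mathcal A\models Q(\mathbf a)$ means that $\mathbf a\in\mathrm{ind}(\mathcal A)^{\mathrm{ar}(q)}$ is an answer to $q$ on every common model of $\mathcal A$ and $\mathcal T$. The pathwidth of $\mathcal A$ is the least $k\in\mathbb N$ such that there is a sequence $V_1,\dots,V_n\subseteq\mathrm{ind}(\mathcal A)$ of sets of size at most $k+1$ that cover $\mathrm{ind}(\mathcal A)$, with $V_i\cap V_l\subseteq V_j$ for $i\le j\le l$, and with $a,b$ in a common $V_i$ whenever $r(a,b)\in\mathcal A$.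 The OMQ $Q$ has pathwidth at most $k$ if for every $\Sigma$-ABox $\mathcal A$ and tuple $\mathbf a$ with $\mathcal A\models Q(\mathbf a)$ there are a $\Sigma$-ABox $\mathcal A'$ of pathwidth at most $k$ with $\mathcal A'\models Q(\mathbf a)$ and a homomorphism from $\mathcal A'$ to $\mathcal A$ that is the identity on $\mathbf a$. It has bounded pathwidth if this holds for some $k\in\mathbb N$, and then $\mathrm{pw}(Q)$ is the least such $k$. A Datalog program over EDB signature $\Sigma$ is a finite set of rules with non-empty bodies that contain all variables of the heads, in which every relation that occurs in no head is a concept or role name from $\Sigma$, and with a goal relation that occurs in no body; body atoms $\top(x)$, which are vacuously true, are also admitted. Relations occurring in heads are IDB relations. The program is linear if each body contains at most one IDB atom, and its width is the maximum arity of its IDB relations other than the goal ($0$ if there are none). A program $\Pi$ whose goal relation has arity $\mathrm{ar}(q)$ is a rewriting of $Q$ if for all $\Sigma$-ABoxes $\mathcal A$ and all $\mathbf a\in\mathrm{ind}(\mathcal A)^{\mathrm{ar}(q)}$ we have $\mathcal A\models Q(\mathbf a)$ iff $\mathrm{goal}(\mathbf a)$ is a first-order consequence of $\mathcal A\cup\Pi$.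 **Lemma.** Let $Q=(\mathcal T,\Sigma,q)$ be an OMQ from $(\mathcal{ELI},\mathrm{CQ})$. Then $Q$ has bounded pathwidth if and only if there is a linear Datalog program over EDB signature $\Sigma$ that is a rewriting of $Q$. If $Q$ has bounded pathwidth, then there is such a linear Datalog rewriting of width $\mathrm{pw}(Q)+\mathrm{ar}(q)$. -/

import Mathlib

namespace ELI

/-! The three countably infinite sets of names (disjoint, being separate types). -/

abbrev ConceptName : Type := ℕ
abbrev RoleName : Type := ℕ
abbrev Individual : Type := ℕ

/-! ### Concepts, TBoxes, ABoxes -/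

/-- ELI-concepts: `⊤ | A | C ⊓ D | ∃r.C | ∃r⁻.C`. -/
inductive Concept : Type
  | top : Concept
  | name (A : ConceptName) : Concept
  | inter (C D : Concept) : Concept
  | ex (r : RoleName) (C : Concept) : Concept
  | exInv (r : RoleName) (C : Concept) : Concept

/-- An ELI-TBox is a finite set of concept inclusions `C ⊑ D`, here pairs `(C, D)`. -/
abbrev TBox : Type := Finset (Concept × Concept)

/-- Concept assertions `A(a)` and role assertions `r(a, b)`. -/
inductive Assertion : Type
  | concept (A : ConceptName) (a : Individual) : Assertion
  | role (r : RoleName) (a b : Individual) : Assertion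

/-- An ABox is a finite set of assertions. -/
abbrev ABox : Type := Finset Assertion

/-- A signature is a (possibly infinite) set of concept and role names. -/
structure Signature : Type where
  concepts : Set ConceptName
  roles : Set RoleName

/-- The individuals that occur in an assertion. -/
def Assertion.inds : Assertion → Set Individual
  | .concept _ a => {a}
  | .role _ a b => {a, b}

/-- The assertion uses only symbols of the signature. -/
def Assertion.Over (S : Signature) : Assertion → Prop
  | .concept A _ => A ∈ S.concepts
  | .role r _ _ => r ∈ S.roles

/-- `ind(𝒜)`, the individuals of an ABox. -/
def ABox.ind (𝒜 : ABox) : Set Individual := {a | ∃ α ∈ 𝒜, a ∈ α.inds}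

/-- `𝒜` is an `S`-ABox. -/
def ABox.Over (𝒜 : ABox) (S : Signature) : Prop := ∀ α ∈ 𝒜, α.Over S

/-- `h` is a homomorphism from `𝒜` to `ℬ`. Every individual of an ABox occurs in an assertion,
so `h` maps `ind(𝒜)` to `ind(ℬ)`; its values outside `ind(𝒜)` play no role. -/
def ABox.IsHom (𝒜 ℬ : ABox) (h : Individual → Individual) : Prop :=
  (∀ A a, Assertion.concept A a ∈ 𝒜 → Assertion.concept A (h a) ∈ ℬ) ∧
  (∀ r a b, Assertion.role r a b ∈ 𝒜 → Assertion.role r (h a) (h b) ∈ ℬ)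

/-! ### Semantics -/

/-- An interpretation of the concept and role names on the domain `D`. -/
structure Interp (D : Type) : Type where
  concept : ConceptName → Set D
  role : RoleName → D → D → Prop

/-- The extension of an ELI-concept. -/
def Interp.ext {D : Type} (I : Interp D) : Concept → Set D
  | .top => Set.univ
  | .name A => I.concept A
  | .inter C C' => I.ext C ∩ I.ext C'
  | .ex r C => {d | ∃ e, I.role r d e ∧ e ∈ I.ext C}
  | .exInv r C => {e | ∃ d, I.role r d e ∧ d ∈ I.ext C}

def Interp.ModelsTBox {D : Type} (I : Interp D) (T : TBox) : Prop :=
  ∀ ci ∈ T, I.ext ci.1 ⊆ I.ext ci.2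

/-- `I` satisfies an assertion when the individual names denote domain elements via `ι`. -/
def Interp.Sat {D : Type} (I : Interp D) (ι : Individual → D) : Assertion → Prop
  | .concept A a => ι a ∈ I.concept A
  | .role r a b => I.role r (ι a) (ι b)

def Interp.ModelsABox {D : Type} (I : Interp D) (ι : Individual → D) (𝒜 : ABox) : Prop :=
  ∀ α ∈ 𝒜, I.Sat ι α

/-! ### Conjunctive queries and ontology-mediated queries -/

/-- Unary and binary atoms over a set `V` of variables. -/
inductive QAtom (V : Type) : Type
  | concept (A : ConceptName) (x : V) : QAtom V
  | role (r : RoleName) (x y : V) : QAtom V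

/-- A conjunctive query without equality, as the set of its atoms. Its answer variables are
`Sum.inl 0, …, Sum.inl (arity - 1)`; the other variables `Sum.inr i` are existentially
quantified. -/
structure CQ : Type where
  arity : ℕ
  atoms : Finset (QAtom (Fin arity ⊕ ℕ))

/-- The variable assignment `h` satisfies a query atom in `I`. -/
def Interp.SatQ {D V : Type} (I : Interp D) (h : V → D) : QAtom V → Prop
  | .concept A x => h x ∈ I.concept A
  | .role r x y => I.role r (h x) (h y)

/-- `d` is an answer to `q` on `I`: some homomorphism from `q` to `I` maps the answer variables
to `d`. -/
def Interp.IsAnswer {D : Type} (I : Interp D) (q : CQ) (d : Fin q.arity → D) : Prop :=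
  ∃ h : Fin q.arity ⊕ ℕ → D, (∀ i, h (Sum.inl i) = d i) ∧ ∀ α ∈ q.atoms, I.SatQ h α

/-- An ontology-mediated query `(T, S, q)` from (ELI, CQ). -/
structure OMQ : Type where
  tbox : TBox
  sig : Signature
  query : CQ

/-- `𝒜 ⊨ Q(a)`: the tuple `a` consists of individuals of `𝒜` and is an answer to the query on
every common model of `𝒜` and the TBox. In a model of `𝒜`, distinct individuals of `𝒜` are
distinct domain elements (standard names), that is, `ι` is injective on `ind(𝒜)`. -/
def OMQ.Entails (Q : OMQ) (𝒜 : ABox) (a : Fin Q.query.arity → Individual) : Prop :=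
  (∀ i, a i ∈ 𝒜.ind) ∧
  ∀ (D : Type) [Nonempty D] (I : Interp D) (ι : Individual → D),
    Set.InjOn ι 𝒜.ind → I.ModelsABox ι 𝒜 → I.ModelsTBox Q.tbox →
      I.IsAnswer Q.query (fun i => ι (a i))

/-! ### Pathwidth -/

/-- `bags 0, …, bags (n - 1)` is a path decomposition of the graph `(V, E)`. -/
structure IsPathDecomposition {α : Type} (V : Set α) (E : α → α → Prop) {n : ℕ}
    (bags : Fin n → Finset α) : Prop where
  subset : ∀ i, ∀ x ∈ bags i, x ∈ V
  cover : ∀ x ∈ V, ∃ i, x ∈ bags i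
  edge : ∀ x y, E x y → ∃ i, x ∈ bags i ∧ y ∈ bags i
  convex : ∀ i j k : Fin n, i ≤ j → j ≤ k → ∀ x, x ∈ bags i → x ∈ bags k → x ∈ bags j

/-- The edges of the directed graph `G_𝒜`. -/
def ABox.Edge (𝒜 : ABox) (a b : Individual) : Prop := ∃ r, Assertion.role r a b ∈ 𝒜

/-- The pathwidth of an ABox: the least natural number `k` such that `G_𝒜` has a path
decomposition into bags of size at most `k + 1`. -/
noncomputable def ABox.pathwidth (𝒜 : ABox) : ℕ :=
  sInf {k | ∃ (n : ℕ) (bags : Fin n → Finset Individual),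
    IsPathDecomposition 𝒜.ind 𝒜.Edge bags ∧ ∀ i, (bags i).card ≤ k + 1}

/-- `Q` has pathwidth at most `k`. -/
def OMQ.PathwidthAtMost (Q : OMQ) (k : ℕ) : Prop :=
  ∀ (𝒜 : ABox) (a : Fin Q.query.arity → Individual), 𝒜.Over Q.sig → Q.Entails 𝒜 a →
    ∃ 𝒜' : ABox, 𝒜'.Over Q.sig ∧ 𝒜'.pathwidth ≤ k ∧ Q.Entails 𝒜' a ∧
      ∃ h : Individual → Individual, 𝒜'.IsHom 𝒜 h ∧ ∀ i, h (a i) = a i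

def OMQ.BoundedPathwidth (Q : OMQ) : Prop := ∃ k, Q.PathwidthAtMost k

/-- `pw(Q)`, for `Q` of bounded pathwidth. -/
noncomputable def OMQ.pathwidth (Q : OMQ) : ℕ := sInf {k | Q.PathwidthAtMost k}

/-! ### Datalog

Variables of rules are natural numbers. A non-goal IDB relation is given by a name together with
an arity: in `idb P xs` the arity is `xs.length`, and the same name with tuples of different
lengths denotes different relations. -/

/-- Atoms of rule bodies: EDB atoms, atoms `⊤(x)`, and atoms of non-goal IDB relations. -/
inductive BodyAtom : Type
  | concept (A : ConceptName) (x : ℕ) : BodyAtom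
  | role (r : RoleName) (x y : ℕ) : BodyAtom
  | top (x : ℕ) : BodyAtom
  | idb (P : ℕ) (xs : List ℕ) : BodyAtom

/-- Atoms of rule heads; `n` is the arity of the goal relation. -/
inductive HeadAtom (n : ℕ) : Type
  | idb (P : ℕ) (xs : List ℕ) : HeadAtom n
  | goal (xs : Fin n → ℕ) : HeadAtom n

def BodyAtom.vars : BodyAtom → Set ℕ
  | .concept _ x => {x}
  | .role _ x y => {x, y}
  | .top x => {x}
  | .idb _ xs => {x | x ∈ xs}

def HeadAtom.vars {n : ℕ} : HeadAtom n → Set ℕ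
  | .idb _ xs => {x | x ∈ xs}
  | .goal xs => Set.range xs

def BodyAtom.isIDB : BodyAtom → Bool
  | .idb _ _ => true
  | _ => false

/-- A Datalog rule: a non-empty body that contains every variable of the head. -/
structure Rule (n : ℕ) : Type where
  head : HeadAtom n
  body : List BodyAtom
  body_ne : body ≠ []
  safe : ∀ x ∈ head.vars, ∃ α ∈ body, x ∈ α.vars

/-- A Datalog program whose goal relation has arity `n`. The goal relation does not occur in
bodies, it is an IDB relation, and every relation symbol in a body other than a concept or role
name is the head relation of some rule. -/
structure Program (n : ℕ) : Type where
  rules : Finset (Rule n)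
  goal_isIDB : ∃ ρ ∈ rules, ∃ xs, ρ.head = .goal xs
  idb_isIDB : ∀ ρ ∈ rules, ∀ P xs, BodyAtom.idb P xs ∈ ρ.body →
    ∃ ρ' ∈ rules, ∃ ys : List ℕ, ρ'.head = .idb P ys ∧ ys.length = xs.length

def BodyAtom.Over (S : Signature) : BodyAtom → Prop
  | .concept A _ => A ∈ S.concepts
  | .role r _ _ => r ∈ S.roles
  | .top _ => True
  | .idb _ _ => True

/-- All EDB relations of the program are in `S`. -/
def Program.Over {n : ℕ} (p : Program n) (S : Signature) : Prop :=
  ∀ ρ ∈ p.rules, ∀ α ∈ ρ.body, α.Over S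

/-- Every rule body contains at most one IDB atom. -/
def Program.IsLinear {n : ℕ} (p : Program n) : Prop :=
  ∀ ρ ∈ p.rules, ρ.body.countP BodyAtom.isIDB ≤ 1

/-- The maximum arity of the non-goal IDB relations (`0` if there are none). -/
noncomputable def Program.width {n : ℕ} (p : Program n) : ℕ :=
  sSup {m | ∃ ρ ∈ p.rules, ∃ P xs,
    (ρ.head = .idb P xs ∨ BodyAtom.idb P xs ∈ ρ.body) ∧ xs.length = m}

/-- A first-order structure for the relation symbols of Datalog programs of arity `n`. -/
structure DStruct (n : ℕ) (D : Type) : Type extends Interp D where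
  idb : ℕ → List D → Prop
  goal : (Fin n → D) → Prop

def DStruct.SatBody {n : ℕ} {D : Type} (M : DStruct n D) (σ : ℕ → D) : BodyAtom → Prop
  | .concept A x => σ x ∈ M.concept A
  | .role r x y => M.role r (σ x) (σ y)
  | .top _ => True
  | .idb P xs => M.idb P (xs.map σ)

def DStruct.SatHead {n : ℕ} {D : Type} (M : DStruct n D) (σ : ℕ → D) : HeadAtom n → Prop
  | .idb P xs => M.idb P (xs.map σ)
  | .goal xs => M.goal (fun i => σ (xs i))

/-- `M` satisfies all rules, with their variables universally quantified. -/
def DStruct.ModelsProgram {n : ℕ} {D : Type} (M : DStruct n D) (p : Program n) : Prop :=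
  ∀ ρ ∈ p.rules, ∀ σ : ℕ → D, (∀ α ∈ ρ.body, M.SatBody σ α) → M.SatHead σ ρ.head

/-- `𝒜 ⊨ Π(a)`: `goal(a)` is a logical consequence of the ABox and the rules, viewed as
first-order sentences with the individuals as constants. -/
def Program.Entails {n : ℕ} (p : Program n) (𝒜 : ABox) (a : Fin n → Individual) : Prop :=
  ∀ (D : Type) [Nonempty D] (M : DStruct n D) (ι : Individual → D),
    M.toInterp.ModelsABox ι 𝒜 → M.ModelsProgram p → M.goal (fun i => ι (a i))

/-- The program is a rewriting of `Q`. -/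
def OMQ.IsRewriting (Q : OMQ) (p : Program Q.query.arity) : Prop :=
  p.Over Q.sig ∧
  ∀ (𝒜 : ABox) (a : Fin Q.query.arity → Individual), 𝒜.Over Q.sig → (∀ i, a i ∈ 𝒜.ind) →
    (Q.Entails 𝒜 a ↔ p.Entails 𝒜 a)

def OMQ.LinearDatalogRewritable (Q : OMQ) : Prop :=
  ∃ p : Program Q.query.arity, p.IsLinear ∧ Q.IsRewriting p

end ELI

/-!
From bounded pathwidth to a linear program. The *type* of an `m`-tuple in a model of the TBox records
the equalities between its entries, the subconcepts of the TBox that hold at them, and the subqueries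
of `q` that hold with some variables fixed to entries (`Interp.tupleType`). There are finitely many
types. If two models of the TBox are glued along tuples of the same type, then the result is a model
of the TBox (`IsAmalgam.modelsTBox`), and the tuples of the two models keep their types
(`IsAmalgam.tupleType_eq`). The program has an IDB relation for every set `S` of types, which stands
for the tuples with a type in `S`, and consists of all linear rules over a fixed finite set of names
and variables that hold in all models of the TBox under this reading (`canonicalProgram`). So it is
sound by construction. For completeness, let the entailing ABox have a path decomposition into bags of
size `k + 1`. With `S` the set of types that a tuple can have in the models of the assertions in the
bags seen so far, the program derives the `S`-fact for the tuple of the answer individuals and of the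
at most `k` individuals shared with the next bag; the rule that passes to the next bag is sound by
gluing (`mem_typesUpTo_succ`). The last set `S` then forces the query. An ABox of larger pathwidth is
reached through a homomorphism. Two facts let the gluing ignore distinctness of individuals and
restrict attention to finitely many names: models may be blown up by a product with `ℕ`, and names
that do not occur in the TBox or the query may be interpreted by the full relations
(`OMQ.Entails.isAnswer`).

From a linear program to bounded pathwidth. A derivation of a linear program is a sequence of rule
applications, each of which shares with the previous one only the individuals of one IDB fact. Taking
fresh copies of the individuals that are not shared, but keeping the answer individuals throughout,
turns the derivation into an ABox with a path decomposition whose bags are the images of the rules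
(`IsUnravelling.extend`). The facts derived by such ABoxes form a model of the program
(`unravellingStruct_modelsProgram`), hence include all its consequences.
-/

namespace ELI

/-! ### Gluing interpretations along tuples -/

open Classical in
/-- The subconcepts of a concept, including the concept itself. -/
noncomputable def Concept.subs : Concept → Finset Concept
  | .top => {.top}
  | .name A => {.name A}
  | .inter C D => insert (.inter C D) (C.subs ∪ D.subs)
  | .ex r C => insert (.ex r C) C.subs
  | .exInv r C => insert (.exInv r C) C.subs

theorem Concept.self_mem_subs (C : Concept) : C ∈ C.subs := by
  cases C <;> simp [Concept.subs]

open Classical in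
/-- The subconcepts of the concepts that occur in a TBox. -/
noncomputable def TBox.subs (T : TBox) : Finset Concept :=
  T.biUnion fun ci => ci.1.subs ∪ ci.2.subs

theorem TBox.subs_left {T : TBox} {ci : Concept × Concept} (h : ci ∈ T) : ci.1.subs ⊆ T.subs := by
  intro C hC
  simp only [TBox.subs, Finset.mem_biUnion, Finset.mem_union]
  exact ⟨ci, h, .inl hC⟩

theorem TBox.subs_right {T : TBox} {ci : Concept × Concept} (h : ci ∈ T) :
    ci.2.subs ⊆ T.subs := by
  intro C hC
  simp only [TBox.subs, Finset.mem_biUnion, Finset.mem_union]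
  exact ⟨ci, h, .inr hC⟩

theorem Concept.subs_trans {C C' : Concept} (h : C' ∈ C.subs) : C'.subs ⊆ C.subs := by
  induction C with
  | top | name =>
    simp only [Concept.subs, Finset.mem_singleton] at h
    rw [h]
  | inter C D ih ih' =>
    simp only [Concept.subs, Finset.mem_insert, Finset.mem_union] at h
    rcases h with rfl | h | h
    · exact subset_rfl
    · intro X hX
      simp [Concept.subs, ih h hX]
    · intro X hX
      simp [Concept.subs, ih' h hX]
  | ex r C ih | exInv r C ih =>
    simp only [Concept.subs, Finset.mem_insert] at h
    rcases h with rfl | h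
    · exact subset_rfl
    · intro X hX
      simp [Concept.subs, ih h hX]

theorem TBox.subs_trans {T : TBox} {C C' : Concept} (hC : C ∈ T.subs) (h : C' ∈ C.subs) :
    C' ∈ T.subs := by
  simp only [TBox.subs, Finset.mem_biUnion, Finset.mem_union] at hC ⊢
  obtain ⟨ci, hci, h1 | h1⟩ := hC
  · exact ⟨ci, hci, .inl (Concept.subs_trans h1 h)⟩
  · exact ⟨ci, hci, .inr (Concept.subs_trans h1 h)⟩

/-- The union of the images of `I` and `J` in a common domain. -/
def Interp.glue {D E K : Type} (I : Interp D) (J : Interp E) (g : D → K) (f : E → K) :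
    Interp K where
  concept A := g '' I.concept A ∪ f '' J.concept A
  role r u v := (∃ d d', g d = u ∧ g d' = v ∧ I.role r d d') ∨
    (∃ e e', f e = u ∧ f e' = v ∧ J.role r e e')

/-- `g` and `f` embed `D` and `E` jointly onto `K`, and identify at most the elements
`x i` and `c i`, for equal `i`. -/
structure IsAmalgam {D E K : Type} {m : ℕ} (x : Fin m → D) (c : Fin m → E)
    (g : D → K) (f : E → K) : Prop where
  inj_left : Function.Injective g
  inj_right : Function.Injective f
  glued : ∀ i, g (x i) = f (c i)
  overlap : ∀ d e, g d = f e → ∃ i, x i = d ∧ c i = e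
  covers : ∀ u, (∃ d, g d = u) ∨ (∃ e, f e = u)

/-- Tuples with the same equalities between their entries can be amalgamated. -/
theorem exists_isAmalgam {D E : Type} {m : ℕ} (x : Fin m → D) (c : Fin m → E)
    (h : ∀ i j, x i = x j ↔ c i = c j) :
    ∃ (K : Type) (g : D → K) (f : E → K), IsAmalgam x c g f := by
  classical
  let f : E → D ⊕ {e : E // ¬ ∃ i, c i = e} := fun e =>
    if he : ∃ i, c i = e then .inl (x he.choose) else .inr ⟨e, he⟩
  have hf : ∀ i, f (c i) = .inl (x i) := by
    intro i
    have he : ∃ j, c j = c i := ⟨i, rfl⟩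
    simp only [f, dif_pos he]
    exact congrArg _ ((h _ _).2 he.choose_spec)
  have hf' : ∀ e (he : ¬ ∃ i, c i = e), f e = .inr ⟨e, he⟩ := fun e he => by
    simp only [f, dif_neg he]
  refine ⟨_, Sum.inl, f, Sum.inl_injective, ?_, fun i => (hf i).symm, ?_, ?_⟩
  · intro e e' hee
    by_cases he : ∃ i, c i = e <;> by_cases he' : ∃ i, c i = e'
    · obtain ⟨i, rfl⟩ := he
      obtain ⟨j, rfl⟩ := he'
      rw [hf, hf] at hee
      exact (h _ _).1 (Sum.inl_injective hee)
    · obtain ⟨i, rfl⟩ := he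
      rw [hf, hf' _ he'] at hee
      cases hee
    · obtain ⟨i, rfl⟩ := he'
      rw [hf, hf' _ he] at hee
      cases hee
    · rw [hf' _ he, hf' _ he'] at hee
      simpa using hee
  · intro d e hde
    by_cases he : ∃ i, c i = e
    · obtain ⟨i, rfl⟩ := he
      rw [hf] at hde
      exact ⟨i, (Sum.inl_injective hde).symm, rfl⟩
    · rw [hf' _ he] at hde
      cases hde
  · rintro (d | ⟨e, he⟩)
    · exact .inl ⟨d, rfl⟩
    · exact .inr ⟨e, hf' e he⟩

section Glue

variable {D E K : Type} {m : ℕ} {I : Interp D} {J : Interp E} {x : Fin m → D} {c : Fin m → E}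
  {g : D → K} {f : E → K}

/-- Gluing does not change the extension of a concept if the glued elements agree on all its
subconcepts: an edge contributed by the other side leaves from a glued element, which has such a
witness on its own side as well. -/
theorem IsAmalgam.ext_iff (hK : IsAmalgam x c g f) (C : Concept)
    (hC : ∀ C' ∈ C.subs, ∀ i, x i ∈ I.ext C' ↔ c i ∈ J.ext C') :
    (∀ d, g d ∈ (I.glue J g f).ext C ↔ d ∈ I.ext C) ∧
    (∀ e, f e ∈ (I.glue J g f).ext C ↔ e ∈ J.ext C) := by
  have hself := hC C C.self_mem_subs
  induction C with
  | top => simp [Interp.ext]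
  | name A =>
    constructor
    · intro d
      constructor
      · rintro (⟨d', hd', h⟩ | ⟨e, he, h⟩)
        · rwa [← hK.inj_left h]
        · obtain ⟨i, rfl, rfl⟩ := hK.overlap _ _ h.symm
          exact (hself i).2 he
      · exact fun h => .inl ⟨d, h, rfl⟩
    · intro e
      constructor
      · rintro (⟨d', hd', h⟩ | ⟨e, he, h⟩)
        · obtain ⟨i, rfl, rfl⟩ := hK.overlap _ _ h
          exact (hself i).1 hd'
        · rwa [← hK.inj_right h]
      · exact fun h => .inr ⟨e, h, rfl⟩
  | inter C C' ih ih' =>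
    have h1 := ih (fun X hX => hC X (by simp [Concept.subs, hX])) (hC C (by
      simp [Concept.subs, C.self_mem_subs]))
    have h2 := ih' (fun X hX => hC X (by simp [Concept.subs, hX])) (hC C' (by
      simp [Concept.subs, C'.self_mem_subs]))
    simp only [Interp.ext, Set.mem_inter_iff]
    exact ⟨fun d => and_congr (h1.1 d) (h2.1 d), fun e => and_congr (h1.2 e) (h2.2 e)⟩
  | ex r C ih =>
    have h1 := ih (fun X hX => hC X (by simp [Concept.subs, hX])) (hC C (by
      simp [Concept.subs, C.self_mem_subs]))
    constructor
    · intro d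
      constructor
      · rintro ⟨u, ⟨d1, d2, h, rfl, hr⟩ | ⟨e1, e2, h, rfl, hr⟩, hu⟩
        · obtain rfl := hK.inj_left h
          exact ⟨d2, hr, (h1.1 _).1 hu⟩
        · obtain ⟨i, rfl, rfl⟩ := hK.overlap _ _ h.symm
          exact (hself i).2 ⟨e2, hr, (h1.2 _).1 hu⟩
      · rintro ⟨d', hr, hd'⟩
        exact ⟨g d', .inl ⟨d, d', rfl, rfl, hr⟩, (h1.1 _).2 hd'⟩
    · intro e
      constructor
      · rintro ⟨u, ⟨d1, d2, h, rfl, hr⟩ | ⟨e1, e2, h, rfl, hr⟩, hu⟩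
        · obtain ⟨i, rfl, rfl⟩ := hK.overlap _ _ h
          exact (hself i).1 ⟨d2, hr, (h1.1 _).1 hu⟩
        · obtain rfl := hK.inj_right h
          exact ⟨e2, hr, (h1.2 _).1 hu⟩
      · rintro ⟨e', hr, he'⟩
        exact ⟨f e', .inr ⟨e, e', rfl, rfl, hr⟩, (h1.2 _).2 he'⟩
  | exInv r C ih =>
    have h1 := ih (fun X hX => hC X (by simp [Concept.subs, hX])) (hC C (by
      simp [Concept.subs, C.self_mem_subs]))
    constructor
    · intro d
      constructor
      · rintro ⟨u, ⟨d1, d2, rfl, h, hr⟩ | ⟨e1, e2, rfl, h, hr⟩, hu⟩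
        · obtain rfl := hK.inj_left h
          exact ⟨d1, hr, (h1.1 _).1 hu⟩
        · obtain ⟨i, rfl, rfl⟩ := hK.overlap _ _ h.symm
          exact (hself i).2 ⟨e1, hr, (h1.2 _).1 hu⟩
      · rintro ⟨d', hr, hd'⟩
        exact ⟨g d', .inl ⟨d', d, rfl, rfl, hr⟩, (h1.1 _).2 hd'⟩
    · intro e
      constructor
      · rintro ⟨u, ⟨d1, d2, rfl, h, hr⟩ | ⟨e1, e2, rfl, h, hr⟩, hu⟩
        · obtain ⟨i, rfl, rfl⟩ := hK.overlap _ _ h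
          exact (hself i).1 ⟨d1, hr, (h1.1 _).1 hu⟩
        · obtain rfl := hK.inj_right h
          exact ⟨e1, hr, (h1.2 _).1 hu⟩
      · rintro ⟨e', hr, he'⟩
        exact ⟨f e', .inr ⟨e', e, rfl, rfl, hr⟩, (h1.2 _).2 he'⟩

theorem IsAmalgam.modelsTBox (hK : IsAmalgam x c g f) {T : TBox}
    (hx : ∀ C ∈ T.subs, ∀ i, x i ∈ I.ext C ↔ c i ∈ J.ext C)
    (hI : I.ModelsTBox T) (hJ : J.ModelsTBox T) : (I.glue J g f).ModelsTBox T := by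
  intro ci hci u hu
  have h1 := hK.ext_iff ci.1 fun C hC => hx C (TBox.subs_left hci hC)
  have h2 := hK.ext_iff ci.2 fun C hC => hx C (TBox.subs_right hci hC)
  rcases hK.covers u with ⟨d, rfl⟩ | ⟨e, rfl⟩
  · exact (h2.1 d).2 (hI ci hci ((h1.1 d).1 hu))
  · exact (h2.2 e).2 (hJ ci hci ((h1.2 e).1 hu))

theorem Interp.glue_sat_left {α : Assertion} {ι : Individual → D}
    (h : I.Sat ι α) : (I.glue J g f).Sat (g ∘ ι) α := by
  cases α with
  | concept A a => exact .inl ⟨_, h, rfl⟩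
  | role r a b => exact .inl ⟨_, _, rfl, rfl, h⟩

theorem Interp.glue_sat_right {α : Assertion} {ι : Individual → E}
    (h : J.Sat ι α) : (I.glue J g f).Sat (f ∘ ι) α := by
  cases α with
  | concept A a => exact .inr ⟨_, h, rfl⟩
  | role r a b => exact .inr ⟨_, _, rfl, rfl, h⟩

theorem Interp.glue_satQ_left {V : Type} {α : QAtom V} {h : V → D}
    (hα : I.SatQ h α) : (I.glue J g f).SatQ (g ∘ h) α := by
  cases α with
  | concept A a => exact .inl ⟨_, hα, rfl⟩
  | role r a b => exact .inl ⟨_, _, rfl, rfl, hα⟩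

end Glue

theorem Interp.sat_congr {D : Type} {I : Interp D} {α : Assertion} {ι κ : Individual → D}
    (h : ∀ y ∈ α.inds, ι y = κ y) : I.Sat ι α ↔ I.Sat κ α := by
  cases α with
  | concept A a => simp [Interp.Sat, h a (by simp [Assertion.inds])]
  | role r a b =>
    simp [Interp.Sat, h a (by simp [Assertion.inds]), h b (by simp [Assertion.inds])]

def QAtom.vars {V : Type} : QAtom V → Set V
  | .concept _ x => {x}
  | .role _ x y => {x, y}

theorem Interp.satQ_congr {D V : Type} {I : Interp D} {α : QAtom V} {h h' : V → D}
    (hh : ∀ y ∈ α.vars, h y = h' y) : I.SatQ h α ↔ I.SatQ h' α := by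
  cases α with
  | concept A a => simp [Interp.SatQ, hh a (by simp [QAtom.vars])]
  | role r a b =>
    simp [Interp.SatQ, hh a (by simp [QAtom.vars]), hh b (by simp [QAtom.vars])]

/-- An atom that holds in a glued interpretation holds on one of the two sides; `p` and `r` are
partial inverses of the embeddings. -/
theorem Interp.glue_satQ {D E K V : Type} {I : Interp D} {J : Interp E} {g : D → K} {f : E → K}
    (hg : Function.Injective g) (hf : Function.Injective f) {h : V → K} {p : V → D} {r : V → E}
    (hp : ∀ v, (∃ d, g d = h v) → g (p v) = h v) (hr : ∀ v, (∃ e, f e = h v) → f (r v) = h v)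
    {α : QAtom V} (hα : (I.glue J g f).SatQ h α) :
    (I.SatQ p α ∧ ∀ v ∈ α.vars, g (p v) = h v) ∨
    (J.SatQ r α ∧ ∀ v ∈ α.vars, f (r v) = h v) := by
  have hp' : ∀ v d, g d = h v → p v = d := fun v d h => hg ((hp v ⟨d, h⟩).trans h.symm)
  have hr' : ∀ v e, f e = h v → r v = e := fun v d h => hf ((hr v ⟨d, h⟩).trans h.symm)
  cases α with
  | concept A a =>
    rcases hα with ⟨d, hd, hda⟩ | ⟨d, hd, hda⟩
    · refine .inl ⟨?_, ?_⟩
      · simpa [Interp.SatQ, hp' _ _ hda] using hd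
      · rintro v rfl
        exact hp _ ⟨d, hda⟩
    · refine .inr ⟨?_, ?_⟩
      · simpa [Interp.SatQ, hr' _ _ hda] using hd
      · rintro v rfl
        exact hr _ ⟨d, hda⟩
  | role s a b =>
    rcases hα with ⟨d, d', hd, hd', hs⟩ | ⟨d, d', hd, hd', hs⟩
    · refine .inl ⟨?_, ?_⟩
      · simpa [Interp.SatQ, hp' _ _ hd, hp' _ _ hd'] using hs
      · rintro v (rfl | rfl)
        exacts [hp _ ⟨_, hd⟩, hp _ ⟨_, hd'⟩]
    · refine .inr ⟨?_, ?_⟩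
      · simpa [Interp.SatQ, hr' _ _ hd, hr' _ _ hd'] using hs
      · rintro v (rfl | rfl)
        exacts [hr _ ⟨_, hd⟩, hr _ ⟨_, hd'⟩]

/-! ### Types of tuples -/

/-- The answer variables and the first `B` quantified variables of a query, as a finite family. -/
def CQ.var {n B : ℕ} : Fin n ⊕ Fin B → Fin n ⊕ ℕ := Sum.map id Fin.val

/-- All names and all quantified variables of the atom are smaller than `B`. -/
def QAtom.Below {n : ℕ} (B : ℕ) : QAtom (Fin n ⊕ ℕ) → Prop
  | .concept A x => A < B ∧ x ∈ Set.range (CQ.var (B := B))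
  | .role r x y =>
    r < B ∧ x ∈ Set.range (CQ.var (B := B)) ∧ y ∈ Set.range (CQ.var (B := B))

theorem QAtom.Below.mem_range {n B : ℕ} {α : QAtom (Fin n ⊕ ℕ)} (h : α.Below B) {v}
    (hv : v ∈ α.vars) : v ∈ Set.range (CQ.var (B := B)) := by
  cases α with
  | concept A x =>
    obtain rfl := hv
    exact h.2
  | role r x y =>
    rcases hv with rfl | rfl
    exacts [h.2.1, h.2.2]

/-- Possible types of `m`-tuples: sets of equalities between entries, sets of subconcepts of the
TBox at entries, and sets of subqueries with some variables fixed to entries. The last component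
has finitely many values since only the variables `CQ.var v` can be fixed. -/
abbrev TupleType (T : TBox) (q : CQ) (B m : ℕ) : Type :=
  Set (Fin m × Fin m) × Set (Fin m × {C // C ∈ T.subs}) ×
    Set (Set {α // α ∈ q.atoms} × (Fin q.arity ⊕ Fin B → Option (Fin m)))

/-- The type of a tuple in an interpretation. -/
def Interp.tupleType {D : Type} (I : Interp D) (T : TBox) (q : CQ) (B : ℕ) {m : ℕ}
    (c : Fin m → D) : TupleType T q B m :=
  ({p | c p.1 = c p.2}, {p | c p.1 ∈ I.ext p.2.1},
    {p | ∃ h : Fin q.arity ⊕ ℕ → D, (∀ v i, p.2 v = some i → h (CQ.var v) = c i) ∧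
      ∀ α ∈ p.1, I.SatQ h α.1})

section

variable {T : TBox} {q : CQ} {B m l : ℕ} {D E K : Type} {I : Interp D} {J : Interp E}
  {x : Fin m → D} {c : Fin m → E}

theorem tupleType_eq_apply (h : I.tupleType T q B x = J.tupleType T q B c) (i j : Fin m) :
    x i = x j ↔ c i = c j := by
  have := congrArg Prod.fst h
  exact Set.ext_iff.1 this (i, j)

theorem tupleType_eq_ext (h : I.tupleType T q B x = J.tupleType T q B c) :
    ∀ C ∈ T.subs, ∀ i, x i ∈ I.ext C ↔ c i ∈ J.ext C := by
  intro C hC i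
  have := congrArg (fun t => t.2.1) h
  exact Set.ext_iff.1 this (i, ⟨C, hC⟩)

theorem tupleType_eq_query (h : I.tupleType T q B x = J.tupleType T q B c)
    (s : Set {α // α ∈ q.atoms}) (p : Fin q.arity ⊕ Fin B → Option (Fin m))
    (hc : ∃ h : Fin q.arity ⊕ ℕ → E, (∀ v i, p v = some i → h (CQ.var v) = c i) ∧
      ∀ α ∈ s, J.SatQ h α.1) :
    ∃ h : Fin q.arity ⊕ ℕ → D, (∀ v i, p v = some i → h (CQ.var v) = x i) ∧
      ∀ α ∈ s, I.SatQ h α.1 := by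
  have := congrArg (fun t => t.2.2) h
  exact (Set.ext_iff.1 this (s, p)).2 hc

/-- If `J` is glued to `I` along tuples of equal type, then a match in the result of a subquery of
`q` gives one in `I`: the atoms matched in `J` form a subquery that, with the shared variables
fixed, is recorded in the type and so has a match in `I` as well. -/
theorem IsAmalgam.exists_match {g : D → K} {f : E → K} (hK : IsAmalgam x c g f)
    (ht : I.tupleType T q B x = J.tupleType T q B c) (hB : ∀ α ∈ q.atoms, α.Below B)
    [Nonempty D] [Nonempty E] (s : Set {α // α ∈ q.atoms}) (h : Fin q.arity ⊕ ℕ → K)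
    (hs : ∀ α ∈ s, (I.glue J g f).SatQ h α.1) :
    ∃ h' : Fin q.arity ⊕ ℕ → D, (∀ v d, h v = g d → h' v = d) ∧ ∀ α ∈ s, I.SatQ h' α.1 := by
  classical
  let p : Fin q.arity ⊕ ℕ → D := fun v => Function.invFun g (h v)
  let r : Fin q.arity ⊕ ℕ → E := fun v => Function.invFun f (h v)
  have hp : ∀ v, (∃ d, g d = h v) → g (p v) = h v := fun v hv => Function.invFun_eq hv
  have hr : ∀ v, (∃ e, f e = h v) → f (r v) = h v := fun v hv => Function.invFun_eq hv
  -- the variables matched to glued elements, with positions of these elements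
  let b : Fin q.arity ⊕ Fin B → Option (Fin m) := fun v =>
    if hv : ∃ i, g (x i) = h (CQ.var v) then some hv.choose else none
  have hb : ∀ v i, b v = some i → g (x i) = h (CQ.var v) := by
    intro v i hvi
    by_cases hv : ∃ i, g (x i) = h (CQ.var v)
    · simp only [b, dif_pos hv, Option.some.injEq] at hvi
      exact hvi ▸ hv.choose_spec
    · simp only [b, dif_neg hv] at hvi
      cases hvi
  have hb' : ∀ v, (∃ i, g (x i) = h (CQ.var v)) → ∃ i, b v = some i := by
    intro v hv
    exact ⟨_, dif_pos hv⟩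
  obtain ⟨k, hk, hks⟩ := tupleType_eq_query ht
    {α | J.SatQ r α.1 ∧ ∀ v ∈ α.1.vars, f (r v) = h v} b
    ⟨r, fun v i hvi => by
      have h1 := hb v i hvi
      rw [hK.glued] at h1
      exact hK.inj_right ((hr _ ⟨_, h1⟩).trans h1.symm), fun α hα => hα.1⟩
  refine ⟨fun v => if ∃ d, g d = h v then p v else k v, ?_, ?_⟩
  · intro v d hd
    have hv : ∃ d, g d = h v := ⟨d, hd.symm⟩
    simp only [if_pos hv]
    exact hK.inj_left ((hp v hv).trans hd)
  · intro α hα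
    rcases Interp.glue_satQ hK.inj_left hK.inj_right hp hr (hs α hα) with ⟨h1, h2⟩ | h1
    · refine (Interp.satQ_congr fun v hv => ?_).2 h1
      exact if_pos ⟨_, h2 v hv⟩
    · refine (Interp.satQ_congr fun v hv => ?_).2 (hks α h1)
      by_cases hgv : ∃ d, g d = h v
      · simp only [if_pos hgv]
        -- the variable is matched on both sides, hence to a glued element
        obtain ⟨d, hd⟩ := hgv
        obtain ⟨i, hi, -⟩ := hK.overlap d (r v) (hd.trans (h1.2 v hv).symm)
        obtain ⟨w, rfl⟩ := (hB _ α.2).mem_range hv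
        obtain ⟨j, hj⟩ := hb' w ⟨i, by rw [hi, hd]⟩
        rw [hk w j hj]
        exact hK.inj_left ((hp _ ⟨d, hd⟩).trans (hb w j hj).symm)
      · simp only [if_neg hgv]

/-- Gluing along tuples of equal type preserves the types of all tuples. -/
theorem IsAmalgam.tupleType_eq {g : D → K} {f : E → K} (hK : IsAmalgam x c g f)
    (ht : I.tupleType T q B x = J.tupleType T q B c) (hB : ∀ α ∈ q.atoms, α.Below B)
    [Nonempty D] [Nonempty E] (z : Fin l → D) :
    (I.glue J g f).tupleType T q B (g ∘ z) = I.tupleType T q B z := by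
  refine Prod.ext ?_ (Prod.ext ?_ ?_)
  · ext ⟨i, j⟩
    exact hK.inj_left.eq_iff
  · ext ⟨i, C, hC⟩
    have hx := tupleType_eq_ext ht
    exact (hK.ext_iff C fun C' h' => hx C' (TBox.subs_trans hC h')).1 (z i)
  · ext ⟨s, p⟩
    constructor
    · rintro ⟨h, hp, hs⟩
      obtain ⟨h', h1, h2⟩ := hK.exists_match ht hB s h hs
      exact ⟨h', fun v i hvi => h1 _ _ (hp v i hvi), h2⟩
    · rintro ⟨h, hp, hs⟩
      exact ⟨g ∘ h, fun v i hvi => congrArg g (hp v i hvi),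
        fun α hα => Interp.glue_satQ_left (hs α hα)⟩

end

/-! ### Names that are irrelevant for a query -/

/-- All concept and role names in the concept are smaller than `B`. -/
def Concept.Below (B : ℕ) : Concept → Prop
  | .top => True
  | .name A => A < B
  | .inter C D => C.Below B ∧ D.Below B
  | .ex r C => r < B ∧ C.Below B
  | .exInv r C => r < B ∧ C.Below B

/-- The concept or role name of the assertion is smaller than `B`. -/
def Assertion.Below (B : ℕ) : Assertion → Prop
  | .concept A _ => A < B
  | .role r _ _ => r < B

theorem Concept.Below.mono {B B' : ℕ} (h : B ≤ B') {C : Concept} (hC : C.Below B) :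
    C.Below B' := by
  induction C with
  | top => trivial
  | name A => exact lt_of_lt_of_le hC h
  | inter C D ih ih' => exact ⟨ih hC.1, ih' hC.2⟩
  | ex r C ih => exact ⟨lt_of_lt_of_le hC.1 h, ih hC.2⟩
  | exInv r C ih => exact ⟨lt_of_lt_of_le hC.1 h, ih hC.2⟩

theorem Concept.exists_below (C : Concept) : ∃ B, C.Below B := by
  induction C with
  | top => exact ⟨0, trivial⟩
  | name A => exact ⟨A + 1, Nat.lt_succ_self A⟩
  | inter C D ih ih' =>
    obtain ⟨B, hB⟩ := ih
    obtain ⟨B', hB'⟩ := ih'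
    exact ⟨max B B', hB.mono (le_max_left _ _), hB'.mono (le_max_right _ _)⟩
  | ex r C ih | exInv r C ih =>
    obtain ⟨B, hB⟩ := ih
    exact ⟨max (r + 1) B, lt_of_lt_of_le (Nat.lt_succ_self r) (le_max_left _ _),
      hB.mono (le_max_right _ _)⟩

theorem CQ.range_var_mono {n B B' : ℕ} (h : B ≤ B') :
    Set.range (CQ.var (n := n) (B := B)) ⊆ Set.range (CQ.var (B := B')) := by
  rintro _ ⟨v | v, rfl⟩
  · exact ⟨.inl v, rfl⟩
  · exact ⟨.inr (v.castLE h), rfl⟩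

theorem CQ.exists_mem_range_var {n : ℕ} (v : Fin n ⊕ ℕ) :
    ∃ B, v ∈ Set.range (CQ.var (n := n) (B := B)) := by
  rcases v with v | v
  · exact ⟨0, .inl v, rfl⟩
  · exact ⟨v + 1, .inr (Fin.last v), rfl⟩

theorem QAtom.Below.mono {n B B' : ℕ} (h : B ≤ B') {α : QAtom (Fin n ⊕ ℕ)} (hα : α.Below B) :
    α.Below B' := by
  cases α with
  | concept A x => exact ⟨lt_of_lt_of_le hα.1 h, CQ.range_var_mono h hα.2⟩
  | role r x y =>
    exact ⟨lt_of_lt_of_le hα.1 h, CQ.range_var_mono h hα.2.1, CQ.range_var_mono h hα.2.2⟩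

theorem QAtom.exists_below {n : ℕ} (α : QAtom (Fin n ⊕ ℕ)) : ∃ B, α.Below B := by
  cases α with
  | concept A x =>
    obtain ⟨B, hB⟩ := CQ.exists_mem_range_var x
    exact ⟨max (A + 1) B, lt_of_lt_of_le (Nat.lt_succ_self A) (le_max_left _ _),
      CQ.range_var_mono (le_max_right _ _) hB⟩
  | role r x y =>
    obtain ⟨B, hB⟩ := CQ.exists_mem_range_var x
    obtain ⟨B', hB'⟩ := CQ.exists_mem_range_var y
    refine ⟨max (r + 1) (max B B'), lt_of_lt_of_le (Nat.lt_succ_self r) (le_max_left _ _),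
      CQ.range_var_mono ?_ hB, CQ.range_var_mono ?_ hB'⟩ <;> simp

theorem exists_uniform_bound {α : Type*} (s : Finset α) {P : ℕ → α → Prop}
    (hmono : ∀ a n n', n ≤ n' → P n a → P n' a) (h : ∀ a, ∃ n, P n a) : ∃ n, ∀ a ∈ s, P n a := by
  choose f hf using h
  exact ⟨s.sup f, fun a ha => hmono a _ _ (Finset.le_sup ha) (hf a)⟩

/-- All names in the TBox and the query, and all quantified variables of the query, are smaller
than `B`. -/
structure OMQ.Below (Q : OMQ) (B : ℕ) : Prop where
  tbox : ∀ ci ∈ Q.tbox, ci.1.Below B ∧ ci.2.Below B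
  query : ∀ α ∈ Q.query.atoms, α.Below B

theorem OMQ.exists_below (Q : OMQ) : ∃ B, Q.Below B := by
  obtain ⟨B, hB⟩ := exists_uniform_bound Q.tbox
    (P := fun B ci => ci.1.Below B ∧ ci.2.Below B)
    (fun _ _ _ h hc => ⟨hc.1.mono h, hc.2.mono h⟩) (fun ci => by
      obtain ⟨B, hB⟩ := ci.1.exists_below
      obtain ⟨B', hB'⟩ := ci.2.exists_below
      exact ⟨max B B', hB.mono (le_max_left _ _), hB'.mono (le_max_right _ _)⟩)
  obtain ⟨B', hB'⟩ := exists_uniform_bound Q.query.atoms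
    (P := fun B α => α.Below B) (fun _ _ _ h hc => hc.mono h) QAtom.exists_below
  exact ⟨max B B', fun ci hci => ⟨(hB ci hci).1.mono (le_max_left _ _),
    (hB ci hci).2.mono (le_max_left _ _)⟩, fun α hα => (hB' α hα).mono (le_max_right _ _)⟩

/-- The product of `I` with `ℕ`, in which all names from `B` on hold everywhere. The second
component leaves room for distinct individuals to denote distinct elements. -/
def Interp.blowUp {D : Type} (I : Interp D) (B : ℕ) : Interp (D × ℕ) where
  concept A := {d | A < B → d.1 ∈ I.concept A}
  role r d e := r < B → I.role r d.1 e.1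

theorem Interp.blowUp_ext {D : Type} (I : Interp D) {B : ℕ} {C : Concept} (hC : C.Below B)
    (d : D × ℕ) : d ∈ (I.blowUp B).ext C ↔ d.1 ∈ I.ext C := by
  induction C generalizing d with
  | top => simp [Interp.ext]
  | name A => exact ⟨fun h => h hC, fun h _ => h⟩
  | inter C D ih ih' => exact and_congr (ih hC.1 d) (ih' hC.2 d)
  | ex r C ih =>
    constructor
    · rintro ⟨e, hr, he⟩
      exact ⟨e.1, hr hC.1, (ih hC.2 e).1 he⟩
    · rintro ⟨e, hr, he⟩
      exact ⟨(e, 0), fun _ => hr, (ih hC.2 (e, 0)).2 he⟩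
  | exInv r C ih =>
    constructor
    · rintro ⟨e, hr, he⟩
      exact ⟨e.1, hr hC.1, (ih hC.2 e).1 he⟩
    · rintro ⟨e, hr, he⟩
      exact ⟨(e, 0), fun _ => hr, (ih hC.2 (e, 0)).2 he⟩

/-- An entailed tuple is an answer in every model of the TBox in which the individuals, not
necessarily distinct, satisfy the assertions that use relevant names. -/
theorem OMQ.Entails.isAnswer {Q : OMQ} {B : ℕ} (hB : Q.Below B) {𝒜 : ABox}
    {a : Fin Q.query.arity → Individual} (h : Q.Entails 𝒜 a) {D : Type} [Nonempty D]
    {I : Interp D} {ι : Individual → D} (hT : I.ModelsTBox Q.tbox)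
    (hA : ∀ α ∈ 𝒜, α.Below B → I.Sat ι α) : I.IsAnswer Q.query (fun i => ι (a i)) := by
  obtain ⟨k, hk, hk'⟩ := h.2 (D × ℕ) (I.blowUp B) (fun y => (ι y, y))
    (fun y _ z _ hyz => congrArg Prod.snd hyz)
    (fun α hα => by
      cases α with
      | concept A b => exact fun hb => hA _ hα hb
      | role r b b' => exact fun hb => hA _ hα hb)
    (fun ci hci d hd => (I.blowUp_ext (hB.tbox ci hci).2 d).2
      (hT ci hci ((I.blowUp_ext (hB.tbox ci hci).1 d).1 hd)))
  refine ⟨fun v => (k v).1, fun i => congrArg Prod.fst (hk i), fun α hα => ?_⟩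
  have h1 := hk' α hα
  have h2 := hB.query α hα
  cases α with
  | concept A b => exact h1 h2.1
  | role r b b' => exact h1 h2.1

/-! ### The canonical linear program -/

section Program

variable (T : TBox) (q : CQ) (B m : ℕ)

/-- The name of the IDB relation for a set of types; there are finitely many such sets. -/
noncomputable def stateName : Set (TupleType T q B m) → ℕ :=
  (Countable.exists_injective_nat (Set (TupleType T q B m))).choose

theorem stateName_injective : Function.Injective (stateName T q B m) :=
  (Countable.exists_injective_nat (Set (TupleType T q B m))).choose_spec

/-- The intended meaning of the IDB relations over `I`: the relation for a set `S` of types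
consists of the tuples whose type is in `S`, and the goal relation of the answers to `q`. -/
def Interp.canon {D : Type} (I : Interp D) : DStruct q.arity D where
  toInterp := I
  idb P xs := ∃ (S : Set (TupleType T q B m)) (c : Fin m → D),
    P = stateName T q B m S ∧ xs = List.ofFn c ∧ I.tupleType T q B c ∈ S
  goal d := I.IsAnswer q d

theorem Interp.canon_idb {D : Type} (I : Interp D) (S : Set (TupleType T q B m)) (c : Fin m → D) :
    (I.canon T q B m).idb (stateName T q B m S) (List.ofFn c) ↔ I.tupleType T q B c ∈ S := by
  constructor
  · rintro ⟨S', c', hS, hc, h⟩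
    obtain rfl := stateName_injective _ _ _ _ hS
    obtain rfl := List.ofFn_injective hc
    exact h
  · exact fun h => ⟨S, c, rfl, rfl, h⟩

/-- EDB atoms with names below `B` and variables below `m + 2`. -/
abbrev EdbAtom : Type := (Fin B × Fin (m + 2)) ⊕ (Fin B × Fin (m + 2) × Fin (m + 2))

variable {B m} in
def EdbAtom.toBody : EdbAtom B m → BodyAtom
  | .inl (A, x) => .concept A x
  | .inr (r, x, y) => .role r x y

/-- Atoms for a set of types, with variables below `m + 2`. -/
abbrev StateAtom : Type := Set (TupleType T q B m) × (Fin m → Fin (m + 2))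

/-- The variables of a tuple, as the argument list of an atom. -/
def argList {m : ℕ} (x : Fin m → Fin (m + 2)) : List ℕ := List.ofFn fun i => (x i : ℕ)

theorem map_argList {m : ℕ} (x : Fin m → Fin (m + 2)) {D : Type} (σ : ℕ → D) :
    (argList x).map σ = List.ofFn fun i => σ (x i) := by
  simp [argList, List.map_ofFn, Function.comp_def]

/-- Shapes of rules: at most one state atom and a set of EDB atoms in the body, and a state atom
or the goal in the head. -/
abbrev RuleShape : Type :=
  (Option (StateAtom T q B m) × Finset (EdbAtom B m)) ×
    (StateAtom T q B m ⊕ (Fin q.arity → Fin (m + 2)))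

variable {T q B m}

/-- The body of a rule; the atoms `⊤(x)` for all variables ensure safety. -/
noncomputable def RuleShape.body (s : RuleShape T q B m) : List BodyAtom :=
  (s.1.1.elim [] fun A => [.idb (stateName T q B m A.1) (argList A.2)]) ++
    (s.1.2.toList.map EdbAtom.toBody ++ (List.range (m + 2)).map .top)

noncomputable def RuleShape.head (s : RuleShape T q B m) : HeadAtom q.arity :=
  s.2.elim (fun A => .idb (stateName T q B m A.1) (argList A.2)) fun y => .goal fun i => y i

noncomputable def RuleShape.rule (s : RuleShape T q B m) : Rule q.arity where
  head := s.head
  body := s.body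
  body_ne := by simp [RuleShape.body, List.range_succ]
  safe := by
    intro x hx
    have hlt : x < m + 2 := by
      rcases s with ⟨s, A | y⟩
      · obtain ⟨i, rfl⟩ := List.mem_ofFn.1 (show x ∈ argList A.2 from hx)
        exact (A.2 i).2
      · obtain ⟨i, rfl⟩ := hx
        exact (y i).2
    exact ⟨.top x, by simp [RuleShape.body, hlt], rfl⟩

theorem RuleShape.mem_body {s : RuleShape T q B m} {α : BodyAtom} :
    α ∈ s.body ↔ (∃ A ∈ s.1.1, α = .idb (stateName T q B m A.1) (argList A.2)) ∨
      (∃ e ∈ s.1.2, α = e.toBody) ∨ ∃ x < m + 2, α = .top x := by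
  rcases s with ⟨⟨_ | A, δ⟩, h⟩ <;>
    simp only [RuleShape.body, Option.elim_none, Option.elim_some, List.mem_append, List.mem_map,
      Finset.mem_toList, List.mem_range, List.mem_singleton, List.not_mem_nil, eq_comm,
      Option.mem_def, reduceCtorEq, false_and, exists_false, false_or, Option.some.injEq,
      exists_eq_left']

theorem EdbAtom.toBody_ne_idb (e : EdbAtom B m) (P : ℕ) (xs : List ℕ) :
    e.toBody ≠ .idb P xs := by
  rcases e with ⟨A, x⟩ | ⟨r, x, y⟩ <;> simp [EdbAtom.toBody]

theorem RuleShape.idb_mem_body {s : RuleShape T q B m} {P : ℕ} {xs : List ℕ}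
    (h : BodyAtom.idb P xs ∈ s.body) :
    ∃ A : StateAtom T q B m, P = stateName T q B m A.1 ∧ xs = argList A.2 := by
  rcases RuleShape.mem_body.1 h with ⟨A, -, hA⟩ | ⟨e, -, he⟩ | ⟨x, -, hx⟩
  · cases hA
    exact ⟨A, rfl, rfl⟩
  · exact absurd he.symm (e.toBody_ne_idb P xs)
  · cases hx

/-- A rule belongs to the canonical program if it uses the signature only and holds in all models
of the TBox under the intended meaning of its IDB relations. -/
def RuleShape.Good (S : Signature) (s : RuleShape T q B m) : Prop :=
  (∀ α ∈ s.body, α.Over S) ∧ ∀ (D : Type) [Nonempty D] (I : Interp D), I.ModelsTBox T →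
    ∀ σ : ℕ → D, (∀ α ∈ s.body, (I.canon T q B m).SatBody σ α) →
      (I.canon T q B m).SatHead σ s.head

theorem RuleShape.good_of {S : Signature} {s : RuleShape T q B m}
    (hS : ∀ e ∈ s.1.2, e.toBody.Over S)
    (h : ∀ (D : Type) [Nonempty D] (I : Interp D), I.ModelsTBox T → ∀ σ : ℕ → D,
      (∀ A ∈ s.1.1, I.tupleType T q B (fun i => σ (A.2 i)) ∈ A.1) →
      (∀ e ∈ s.1.2, (I.canon T q B m).SatBody σ e.toBody) →
      s.2.elim (fun A => I.tupleType T q B (fun i => σ (A.2 i)) ∈ A.1)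
        fun y => I.IsAnswer q fun i => σ (y i)) : s.Good S := by
  constructor
  · intro α hα
    rcases RuleShape.mem_body.1 hα with ⟨A, -, rfl⟩ | ⟨e, he, rfl⟩ | ⟨x, -, rfl⟩
    exacts [trivial, hS e he, trivial]
  · intro D _ I hI σ hb
    have h1 := h D I hI σ (fun A hA => by
      have := hb _ (RuleShape.mem_body.2 (.inl ⟨A, hA, rfl⟩))
      simpa only [DStruct.SatBody, map_argList, Interp.canon_idb] using this)
      (fun e he => hb _ (RuleShape.mem_body.2 (.inr (.inl ⟨e, he, rfl⟩))))
    rcases s with ⟨s, A | y⟩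
    · simpa only [RuleShape.head, DStruct.SatHead, Sum.elim_inl, map_argList,
        Interp.canon_idb] using h1
    · exact h1

variable (T q B m)

/-- The linear program of all sound rules. -/
noncomputable def canonicalProgram (S : Signature) : Program q.arity where
  rules := (Set.toFinite (RuleShape.rule '' {s : RuleShape T q B m | s.Good S})).toFinset
  goal_isIDB := by
    -- the rule with the empty set of types in its body is vacuously sound
    let s : RuleShape T q B m := ((some (∅, fun _ => 0), ∅), .inr fun _ => 0)
    refine ⟨s.rule, ?_, fun _ => 0, rfl⟩
    rw [Set.Finite.mem_toFinset]
    exact ⟨s, RuleShape.good_of (by simp [s]) fun D _ I _ σ h _ =>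
      absurd (h _ rfl) (Set.notMem_empty _), rfl⟩
  idb_isIDB := by
    intro ρ hρ P xs hP
    rw [Set.Finite.mem_toFinset] at hρ
    obtain ⟨s, -, rfl⟩ := hρ
    obtain ⟨A, rfl, rfl⟩ := RuleShape.idb_mem_body hP
    let s' : RuleShape T q B m := ((some A, ∅), .inl A)
    refine ⟨s'.rule, ?_, _, rfl, rfl⟩
    rw [Set.Finite.mem_toFinset]
    exact ⟨s', RuleShape.good_of (by simp [s']) fun D _ I _ σ h _ => h _ rfl, rfl⟩

variable {T q B m} {S : Signature}

theorem mem_canonicalProgram {ρ : Rule q.arity} : ρ ∈ (canonicalProgram T q B m S).rules ↔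
    ∃ s : RuleShape T q B m, s.Good S ∧ s.rule = ρ := by
  simp [canonicalProgram]

theorem canonicalProgram_over : (canonicalProgram T q B m S).Over S := by
  intro ρ hρ
  obtain ⟨s, hs, rfl⟩ := mem_canonicalProgram.1 hρ
  exact hs.1

theorem canonicalProgram_isLinear : (canonicalProgram T q B m S).IsLinear := by
  intro ρ hρ
  obtain ⟨⟨⟨A, δ⟩, H⟩, -, rfl⟩ := mem_canonicalProgram.1 hρ
  have h1 : (δ.toList.map EdbAtom.toBody).countP BodyAtom.isIDB = 0 := by
    rw [List.countP_eq_zero]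
    intro α hα
    obtain ⟨e, -, rfl⟩ := List.mem_map.1 hα
    rcases e with ⟨A, x⟩ | ⟨r, x, y⟩ <;> simp [EdbAtom.toBody, BodyAtom.isIDB]
  have h2 : ((List.range (m + 2)).map BodyAtom.top).countP BodyAtom.isIDB = 0 := by
    rw [List.countP_eq_zero]
    intro α hα
    obtain ⟨e, -, rfl⟩ := List.mem_map.1 hα
    simp [BodyAtom.isIDB]
  simp only [RuleShape.rule, RuleShape.body, List.countP_append, h1, h2]
  cases A <;> simp [BodyAtom.isIDB]

theorem canonicalProgram_width : (canonicalProgram T q B m S).width = m := by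
  have : {n | ∃ ρ ∈ (canonicalProgram T q B m S).rules, ∃ P xs,
      (ρ.head = .idb P xs ∨ BodyAtom.idb P xs ∈ ρ.body) ∧ xs.length = n} = {m} := by
    ext n
    simp only [Set.mem_singleton_iff]
    constructor
    · rintro ⟨ρ, hρ, P, xs, h, rfl⟩
      obtain ⟨s, -, rfl⟩ := mem_canonicalProgram.1 hρ
      rcases h with h | h
      · rcases s with ⟨s, A | y⟩
        · have h' : HeadAtom.idb (n := q.arity) (stateName T q B m A.1) (argList A.2) =
            .idb P xs := h
          cases h'
          simp [argList]
        · have h' : HeadAtom.goal (fun i => (y i : ℕ)) = .idb P xs := h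
          cases h'
      · obtain ⟨A, -, rfl⟩ := RuleShape.idb_mem_body h
        simp [argList]
    · rintro rfl
      let A : StateAtom T q B n := (Set.univ, fun _ => 0)
      let s : RuleShape T q B n := ((none, ∅), .inl A)
      exact ⟨s.rule, mem_canonicalProgram.2 ⟨s, RuleShape.good_of (by simp [s])
        fun D _ I _ σ _ _ => Set.mem_univ _, rfl⟩, _, argList A.2, .inl rfl, by simp [argList]⟩
  rw [Program.width, this, csSup_singleton]

theorem canonicalProgram_sound {Q : OMQ} {𝒜 : ABox} {a : Fin Q.query.arity → Individual}
    (ha : ∀ i, a i ∈ 𝒜.ind) (h : (canonicalProgram Q.tbox Q.query B m S).Entails 𝒜 a) :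
    Q.Entails 𝒜 a := by
  refine ⟨ha, fun D _ I ι _ hA hT => ?_⟩
  refine h D (I.canon Q.tbox Q.query B m) ι hA fun ρ hρ σ hb => ?_
  obtain ⟨s, hs, rfl⟩ := mem_canonicalProgram.1 hρ
  exact hs.2 D I hT σ hb

/-- One application of a sound rule. -/
theorem canonicalProgram_derive {D : Type} {M : DStruct q.arity D}
    (hM : M.ModelsProgram (canonicalProgram T q B m S)) {s : RuleShape T q B m} (hs : s.Good S)
    {σ : ℕ → D}
    (hidb : ∀ A ∈ s.1.1, M.idb (stateName T q B m A.1) (List.ofFn fun i => σ (A.2 i)))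
    (hedb : ∀ e ∈ s.1.2, M.SatBody σ e.toBody) :
    s.2.elim (fun A => M.idb (stateName T q B m A.1) (List.ofFn fun i => σ (A.2 i)))
      fun y => M.goal fun i => σ (y i) := by
  have h1 := hM _ (mem_canonicalProgram.2 ⟨s, hs, rfl⟩) σ fun α hα => by
    rcases RuleShape.mem_body.1 hα with ⟨A, hA, rfl⟩ | ⟨e, he, rfl⟩ | ⟨x, -, rfl⟩
    · simpa only [DStruct.SatBody, map_argList] using hidb A hA
    · exact hedb e he
    · trivial
  rcases s with ⟨s, A | y⟩
  · simpa only [RuleShape.rule, RuleShape.head, DStruct.SatHead, Sum.elim_inl, map_argList]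
      using h1
  · exact h1

end Program

/-! ### Derivations along a path decomposition -/

section

variable (B : ℕ) (𝒜 : ABox) (W : ℕ → Finset Individual)

/-- The assertions that use relevant names and lie within one of the bags `W 0, …, W i` hold. -/
def HoldsUpTo (i : ℕ) {D : Type} (I : Interp D) (κ : Individual → D) : Prop :=
  ∀ α ∈ 𝒜, α.Below B → (∃ j ≤ i, ∀ y ∈ α.inds, y ∈ W j) → I.Sat κ α

/-- The types of a tuple of individuals in the models of the TBox and of the assertions within
`W 0, …, W i`. -/
def typesUpTo (T : TBox) (q : CQ) {m : ℕ} (i : ℕ) (c : Fin m → Individual) :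
    Set (TupleType T q B m) :=
  {t | ∃ (D : Type) (_ : Nonempty D) (I : Interp D) (κ : Individual → D),
    I.ModelsTBox T ∧ HoldsUpTo B 𝒜 W i I κ ∧ I.tupleType T q B (fun l => κ (c l)) = t}

variable {B 𝒜 W} {T : TBox} {q : CQ} {m k : ℕ}

/-- The sets `typesUpTo` are updated soundly along the path. Let `I` satisfy the assertions within
the bag `W (i + 1)`, and let the type of `c` in `I` be realized by a model `J` of the assertions
seen before. Then gluing `J` to `I` along `c` gives a model of the assertions up to `W (i + 1)` in
which all tuples from the set `G` have the same type as in `I`. -/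
theorem mem_typesUpTo_succ (hB : ∀ α ∈ q.atoms, α.Below B) {i : ℕ} {c c' : Fin m → Individual}
    {G : Set Individual} (hWG : ∀ y ∈ W (i + 1), y ∈ G)
    (hc'G : ∀ l, c' l ∈ G) (hG : ∀ y ∈ G, ∀ j ≤ i, y ∈ W j → ∃ l, c l = y)
    {D : Type} [Nonempty D] {I : Interp D} (hI : I.ModelsTBox T) {κ : Individual → D}
    (hc : I.tupleType T q B (fun l => κ (c l)) ∈ typesUpTo B 𝒜 W T q i c)
    (hW : ∀ α ∈ 𝒜, α.Below B → (∀ y ∈ α.inds, y ∈ W (i + 1)) → I.Sat κ α) :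
    I.tupleType T q B (fun l => κ (c' l)) ∈ typesUpTo B 𝒜 W T q (i + 1) c' := by
  classical
  obtain ⟨E, _, J, κJ, hJ, hJW, ht⟩ := hc
  obtain ⟨K, g, f, hK⟩ := exists_isAmalgam (fun l => κ (c l)) (fun l => κJ (c l))
    (tupleType_eq_apply ht.symm)
  let κK : Individual → K := fun y => if y ∈ G then g (κ y) else f (κJ y)
  have hκG : ∀ y ∈ G, κK y = g (κ y) := fun y hy => if_pos hy
  refine ⟨K, ⟨g (Classical.arbitrary D)⟩, I.glue J g f, κK,
    hK.modelsTBox (tupleType_eq_ext ht.symm) hI hJ, ?_, ?_⟩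
  · rintro α hα hαB ⟨j, hj, hjW⟩
    rcases Nat.lt_or_ge i j with hij | hij
    · obtain rfl : j = i + 1 := by omega
      refine (Interp.sat_congr fun y hy => ?_).2 (Interp.glue_sat_left (hW α hα hαB hjW))
      exact hκG y (hWG y (hjW y hy))
    · refine (Interp.sat_congr fun y hy => ?_).2
        (Interp.glue_sat_right (hJW α hα hαB ⟨j, hij, hjW⟩))
      by_cases hyG : y ∈ G
      · obtain ⟨l, rfl⟩ := hG y hyG j hij (hjW y hy)
        exact (hκG _ hyG).trans (hK.glued l)
      · exact if_neg hyG
  · have : (fun l => κK (c' l)) = g ∘ fun l => κ (c' l) := funext fun l => hκG _ (hc'G l)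
    rw [this]
    exact hK.tupleType_eq ht.symm hB _

theorem getD_idxOf (L : List Individual) {y p : Individual} (h : y ∈ L ∨ y = p) :
    L.getD (L.idxOf y) p = y := by
  by_cases hy : y ∈ L
  · rw [List.getD_eq_getElem _ _ (List.idxOf_lt_length_of_mem hy)]
    exact List.getElem_idxOf _
  · obtain rfl := h.resolve_left hy
    rw [List.idxOf_eq_length hy, List.getD_eq_default _ _ le_rfl]

/-- At most `m` individuals can be listed in an `m`-tuple, padded with a further individual. -/
theorem exists_tuple {F : Finset Individual} {m : ℕ} (hF : F.card ≤ m) (p : Individual) :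
    ∃ c : Fin m → Individual, (∀ y ∈ F, ∃ l, c l = y) ∧ ∀ l, c l ∈ F ∨ c l = p := by
  refine ⟨fun l => F.toList.getD l p, fun y hy => ?_, fun l => ?_⟩
  · have hy' := Finset.mem_toList.2 hy
    have := List.idxOf_lt_length_of_mem hy'
    rw [Finset.length_toList] at this
    exact ⟨⟨_, this.trans_le hF⟩, getD_idxOf _ (.inl hy')⟩
  · rcases Nat.lt_or_ge l F.toList.length with h | h
    · left
      change F.toList.getD _ _ ∈ F
      rw [List.getD_eq_getElem _ _ h]
      exact Finset.mem_toList.1 (List.getElem_mem h)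
    · exact .inr (List.getD_eq_default _ _ h)

variable {S : Signature}

/-- One rule application that covers a finset `F` of individuals and a padding individual `p`: the
variable of an individual is its position in a list of the elements of `F`. -/
theorem canonicalProgram_derive_on {D : Type} {M : DStruct q.arity D}
    (hM : M.ModelsProgram (canonicalProgram T q B m S)) {ι : Individual → D}
    (hA : M.ModelsABox ι 𝒜) (hS : 𝒜.Over S) {F : Finset Individual} (hF : F.card ≤ m + 1)
    {p : Individual} (s : Option (Set (TupleType T q B m) × (Fin m → Individual)))
    (hs : ∀ A ∈ s, (∀ l, A.2 l ∈ F ∨ A.2 l = p) ∧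
      M.idb (stateName T q B m A.1) (List.ofFn fun l => ι (A.2 l)))
    (H : (Set (TupleType T q B m) × (Fin m → Individual)) ⊕ (Fin q.arity → Individual))
    (hH : H.elim (fun A => ∀ l, A.2 l ∈ F ∨ A.2 l = p) fun y => ∀ i, y i ∈ F ∨ y i = p)
    (hsound : ∀ (D : Type) [Nonempty D] (I : Interp D), I.ModelsTBox T →
      ∀ κ : Individual → D,
      (∀ A ∈ s, I.tupleType T q B (fun l => κ (A.2 l)) ∈ A.1) →
      (∀ α ∈ 𝒜, α.Below B → (∀ y ∈ α.inds, y ∈ F) → I.Sat κ α) →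
      H.elim (fun A => I.tupleType T q B (fun l => κ (A.2 l)) ∈ A.1)
        fun y => I.IsAnswer q fun i => κ (y i)) :
    H.elim (fun A => M.idb (stateName T q B m A.1) (List.ofFn fun l => ι (A.2 l)))
      fun y => M.goal fun i => ι (y i) := by
  classical
  let L := F.toList
  let X : Individual → Fin (m + 2) := fun y => ⟨L.idxOf y, by
    have h1 : L.idxOf y ≤ L.length := List.idxOf_le_length
    have h2 : L.length = F.card := Finset.length_toList F
    omega⟩
  let e : ℕ → Individual := fun n => L.getD n p
  have he : ∀ y, y ∈ F ∨ y = p → e (X y) = y := fun y hy =>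
    getD_idxOf L (hy.imp_left Finset.mem_toList.2)
  let δ : Finset (EdbAtom B m) := Finset.univ.filter fun a => match a with
    | .inl (A, x) => Assertion.concept A (e x) ∈ 𝒜
    | .inr (r, x, y) => Assertion.role r (e x) (e y) ∈ 𝒜
  let r : RuleShape T q B m := ((s.map fun A => (A.1, fun l => X (A.2 l)), δ),
    H.map (fun A => (A.1, fun l => X (A.2 l))) fun y i => X (y i))
  have hr : r.Good S := by
    refine RuleShape.good_of ?_ ?_
    · rintro (⟨A, x⟩ | ⟨r, x, y⟩) ha
      · exact hS _ (Finset.mem_filter.1 ha).2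
      · exact hS _ (Finset.mem_filter.1 ha).2
    · intro D' _ I hI σ h1 h2
      have := hsound D' I hI (fun y => σ (X y)) (fun A hA' => by
        refine h1 (A.1, fun l => X (A.2 l)) ?_
        simp only [r, Option.mem_def.1 hA']
        rfl) (fun α hα hαB hαF => by
          cases α with
          | concept A y =>
            have hy := he y (.inl (hαF y rfl))
            refine h2 (.inl (⟨A, hαB⟩, X y)) (Finset.mem_filter.2 ⟨Finset.mem_univ _, ?_⟩)
            change Assertion.concept A (e (X y)) ∈ 𝒜
            rwa [hy]
          | role r y z =>
            have hy := he y (.inl (hαF y (.inl rfl)))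
            have hz := he z (.inl (hαF z (.inr rfl)))
            refine h2 (.inr (⟨r, hαB⟩, X y, X z)) (Finset.mem_filter.2 ⟨Finset.mem_univ _, ?_⟩)
            change Assertion.role r (e (X y)) (e (X z)) ∈ 𝒜
            rwa [hy, hz])
      cases H <;> exact this
  have key := canonicalProgram_derive hM hr (σ := fun n => ι (e n)) (by
      intro A hA'
      obtain ⟨A, hA1, rfl⟩ := Option.map_eq_some_iff.1 hA'
      obtain ⟨h1, h2⟩ := hs A hA1
      have : (fun l => ι (e (X (A.2 l)))) = fun l => ι (A.2 l) :=
        funext fun l => by rw [he _ (h1 l)]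
      exact this ▸ h2)
    (by
      rintro (⟨A, x⟩ | ⟨r, x, y⟩) ha
      · exact hA _ (Finset.mem_filter.1 ha).2
      · exact hA _ (Finset.mem_filter.1 ha).2)
  rcases H with A | y
  · have : (fun l => ι (e (X (A.2 l)))) = fun l => ι (A.2 l) :=
      funext fun l => by rw [he _ (hH l)]
    simpa only [Sum.elim_inl, Sum.elim_inr, Sum.map_inl, Sum.map_inr, r, this] using key
  · have : (fun l => ι (e (X (y l)))) = fun l => ι (y l) :=
      funext fun l => by rw [he _ (hH l)]
    simpa only [Sum.elim_inl, Sum.elim_inr, Sum.map_inl, Sum.map_inr, r, this] using key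

end

/-- Along a path decomposition of an ABox, the canonical program derives all entailed answers. -/
theorem canonicalProgram_complete_of_path {Q : OMQ} {B k : ℕ} (hB : Q.Below B) {𝒜 : ABox}
    (hS : 𝒜.Over Q.sig) {a : Fin Q.query.arity → Individual} (h : Q.Entails 𝒜 a)
    {W : ℕ → Finset Individual} {n : ℕ} (hcard : ∀ i, (W i).card ≤ k + 1)
    (hind : ∀ i, ∀ y ∈ W i, y ∈ 𝒜.ind)
    (hconv : ∀ i j l, i ≤ j → j ≤ l → ∀ y, y ∈ W i → y ∈ W l → y ∈ W j)
    (hcover : ∀ α ∈ 𝒜, ∃ j ≤ n, ∀ y ∈ α.inds, y ∈ W j) {p : Individual} (hp : p ∉ 𝒜.ind) :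
    (canonicalProgram Q.tbox Q.query B (k + Q.query.arity) Q.sig).Entails 𝒜 a := by
  classical
  intro D _ M ι hA hM
  let R : Finset Individual := Finset.univ.image a
  have hR : R.card ≤ Q.query.arity := Finset.card_image_le.trans (by simp)
  have hRa : ∀ i, a i ∈ R := fun i => Finset.mem_image_of_mem _ (Finset.mem_univ i)
  have hcardR : ∀ i, (W i ∪ R).card ≤ k + Q.query.arity + 1 := fun i => by
    have := Finset.card_union_le (W i) R
    have := hcard i
    omega
  have main : ∀ i, ∀ c : Fin (k + Q.query.arity) → Individual,
      (∀ l, c l ∈ W i ∪ R ∨ c l = p) →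
      M.idb (stateName Q.tbox Q.query B _ (typesUpTo B 𝒜 W Q.tbox Q.query i c))
        (List.ofFn fun l => ι (c l)) := by
    intro i
    induction i with
    | zero =>
      intro c hc
      refine canonicalProgram_derive_on hM hA hS (hcardR 0) none (by simp)
        (.inl (typesUpTo B 𝒜 W Q.tbox Q.query 0 c, c)) hc ?_
      intro D' _ I hI κ _ hκ
      refine ⟨D', ‹_›, I, κ, hI, ?_, rfl⟩
      rintro α hα hαB ⟨j, hj, hjα⟩
      obtain rfl : j = 0 := by omega
      exact hκ α hα hαB fun y hy => Finset.mem_union_left _ (hjα y hy)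
    | succ i ih =>
      intro c' hc'
      by_cases hcap : (W i ∩ W (i + 1)).card ≤ k
      · obtain ⟨c, hc1, hc2⟩ := exists_tuple (F := (W i ∩ W (i + 1)) ∪ R)
          (m := k + Q.query.arity) ((Finset.card_union_le _ _).trans (by omega)) p
        have hci : ∀ l, c l ∈ W i ∪ R ∨ c l = p := fun l => (hc2 l).imp_left fun hl =>
          Finset.union_subset_union Finset.inter_subset_left subset_rfl hl
        have hci' : ∀ l, c l ∈ W (i + 1) ∪ R ∨ c l = p := fun l => (hc2 l).imp_left fun hl =>
          Finset.union_subset_union Finset.inter_subset_right subset_rfl hl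
        refine canonicalProgram_derive_on hM hA hS (hcardR (i + 1))
          (some (typesUpTo B 𝒜 W Q.tbox Q.query i c, c)) ?_
          (.inl (typesUpTo B 𝒜 W Q.tbox Q.query (i + 1) c', c')) hc' ?_
        · rintro A hA'
          obtain rfl := Option.some.inj hA'
          exact ⟨hci', ih c hci⟩
        · intro D' _ I hI κ h1 h2
          refine mem_typesUpTo_succ hB.query (G := {y | y ∈ W (i + 1) ∪ R ∨ y = p})
            (fun y hy => .inl (Finset.mem_union_left _ hy)) hc' ?_ hI (h1 _ rfl)
            (fun α hα hαB hαW => h2 α hα hαB fun y hy => Finset.mem_union_left _ (hαW y hy))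
          rintro y (hy | rfl) j hj hyj
          · apply hc1
            rcases Finset.mem_union.1 hy with hy | hy
            · exact Finset.mem_union_left _ (Finset.mem_inter.2
                ⟨hconv j i (i + 1) hj (Nat.le_succ i) y hyj hy, hy⟩)
            · exact Finset.mem_union_right _ hy
          · exact absurd (hind j _ hyj) hp
      · -- an intersection with `k + 1` elements is only possible for equal bags
        have h1 : W i ∩ W (i + 1) = W i :=
          Finset.eq_of_subset_of_card_le Finset.inter_subset_left (by have := hcard i; omega)
        have h2 : W i ∩ W (i + 1) = W (i + 1) :=
          Finset.eq_of_subset_of_card_le Finset.inter_subset_right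
            (by have := hcard (i + 1); omega)
        have hWW : W (i + 1) = W i := h2.symm.trans h1
        have hT : typesUpTo B 𝒜 W Q.tbox Q.query (i + 1) c' =
            typesUpTo B 𝒜 W Q.tbox Q.query i c' := by
          have : ∀ (D : Type) (I : Interp D) (κ : Individual → D),
              HoldsUpTo B 𝒜 W (i + 1) I κ ↔ HoldsUpTo B 𝒜 W i I κ := by
            intro D I κ
            constructor
            · rintro h α hα hαB ⟨j, hj, hjα⟩
              exact h α hα hαB ⟨j, by omega, hjα⟩
            · rintro h α hα hαB ⟨j, hj, hjα⟩
              rcases Nat.lt_or_ge i j with hij | hij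
              · obtain rfl : j = i + 1 := by omega
                exact h α hα hαB ⟨i, le_rfl, hWW ▸ hjα⟩
              · exact h α hα hαB ⟨j, hij, hjα⟩
          simp only [typesUpTo, this]
        rw [hT]
        exact ih c' (hWW ▸ hc')
  obtain ⟨c, hc1, hc2⟩ := exists_tuple (F := R) (m := k + Q.query.arity) (by omega) p
  refine canonicalProgram_derive_on hM hA hS (F := R) (p := p) (by omega)
    (some (typesUpTo B 𝒜 W Q.tbox Q.query n c, c)) ?_ (.inr a) (fun i => .inl (hRa i)) ?_
  · rintro A hA'
    obtain rfl := Option.some.inj hA'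
    exact ⟨hc2, main n c fun l => (hc2 l).imp_left (Finset.mem_union_right _)⟩
  · intro D' _ I hI κ h1 _
    obtain ⟨E, _, J, κJ, hJ, hJW, ht⟩ := h1 _ rfl
    obtain ⟨g, hg, hgq⟩ := h.isAnswer hB hJ fun α hα hαB => hJW α hα hαB (hcover α hα)
    choose l hl using fun i => hc1 (a i) (hRa i)
    -- the whole query, with its answer variables fixed, belongs to the type
    obtain ⟨g', hg', hgq'⟩ := tupleType_eq_query ht.symm Set.univ
      (Sum.elim (fun i => some (l i)) fun _ => none) ⟨g, by
        refine ⟨?_, fun α _ => hgq α.1 α.2⟩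
        rintro (i | v) j hj
        · obtain rfl := Option.some.inj hj
          simpa [CQ.var, hl] using hg i
        · cases hj⟩
    refine ⟨g', fun i => ?_, fun α hα => hgq' ⟨α, hα⟩ trivial⟩
    exact (hg' (.inl i) (l i) rfl).trans (congrArg κ (hl i))

theorem ABox.ind_finite (𝒜 : ABox) : 𝒜.ind.Finite := by
  have : 𝒜.ind = ⋃ α ∈ 𝒜, α.inds := by
    ext
    simp [ABox.ind]
  rw [this]
  refine 𝒜.finite_toSet.biUnion fun α _ => ?_
  cases α <;> simp [Assertion.inds]

theorem ABox.exists_isPathDecomposition {𝒜 : ABox} {k : ℕ} (h : 𝒜.pathwidth ≤ k) :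
    ∃ (n : ℕ) (bags : Fin n → Finset Individual),
      IsPathDecomposition 𝒜.ind 𝒜.Edge bags ∧ ∀ i, (bags i).card ≤ k + 1 := by
  have hne : {k | ∃ (n : ℕ) (bags : Fin n → Finset Individual),
      IsPathDecomposition 𝒜.ind 𝒜.Edge bags ∧ ∀ i, (bags i).card ≤ k + 1}.Nonempty := by
    -- a single bag with all individuals
    refine ⟨𝒜.ind_finite.toFinset.card, 1, fun _ => 𝒜.ind_finite.toFinset,
      ⟨fun i x hx => by simpa using hx, fun x hx => ⟨0, by simpa using hx⟩, ?_,
        fun i j k _ _ x hx _ => hx⟩, fun i => Nat.le_succ _⟩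
    rintro x y ⟨r, hr⟩
    exact ⟨0, by simpa using ⟨_, hr, .inl rfl⟩, by simpa using ⟨_, hr, .inr rfl⟩⟩
  obtain ⟨n, bags, h1, h2⟩ := Nat.sInf_mem hne
  exact ⟨n, bags, h1, fun i => (h2 i).trans (by have : sInf _ ≤ k := h; omega)⟩

theorem canonicalProgram_complete {Q : OMQ} {B k : ℕ} (hB : Q.Below B) {𝒜 : ABox}
    (hS : 𝒜.Over Q.sig) {a : Fin Q.query.arity → Individual} (h : Q.Entails 𝒜 a)
    (hpw : 𝒜.pathwidth ≤ k) :
    (canonicalProgram Q.tbox Q.query B (k + Q.query.arity) Q.sig).Entails 𝒜 a := by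
  obtain ⟨n, bags, hd, hcard⟩ := ABox.exists_isPathDecomposition hpw
  obtain ⟨p, hp⟩ := 𝒜.ind_finite.exists_notMem
  let W : ℕ → Finset Individual := fun i => if hi : i < n then bags ⟨i, hi⟩ else ∅
  have hW : ∀ i y, y ∈ W i → ∃ hi : i < n, y ∈ bags ⟨i, hi⟩ := by
    intro i y hy
    by_cases hi : i < n
    · simp only [W, dif_pos hi] at hy
      exact ⟨hi, hy⟩
    · simp [W, dif_neg hi] at hy
  have hW' : ∀ (i : Fin n) y, y ∈ bags i → y ∈ W i := by
    intro i y hy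
    simpa [W] using hy
  refine canonicalProgram_complete_of_path (W := W) (n := n) hB hS h ?_ ?_ ?_ ?_ hp
  · intro i
    by_cases hi : i < n
    · simp only [W, dif_pos hi]
      exact hcard _
    · simp [W, dif_neg hi]
  · intro i y hy
    obtain ⟨hi, hy⟩ := hW i y hy
    exact hd.subset _ _ hy
  · intro i j l hij hjl y hyi hyl
    obtain ⟨hi, hyi⟩ := hW i y hyi
    obtain ⟨hl, hyl⟩ := hW l y hyl
    have hj : j < n := by omega
    simp only [W, dif_pos hj]
    exact hd.convex _ _ _ (Fin.mk_le_mk.2 hij) (Fin.mk_le_mk.2 hjl) y hyi hyl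
  · intro α hα
    cases α with
    | concept A y =>
      obtain ⟨i, hi⟩ := hd.cover y ⟨_, hα, rfl⟩
      exact ⟨i, i.2.le, by rintro _ rfl; exact hW' i _ hi⟩
    | role r y z =>
      obtain ⟨i, hy, hz⟩ := hd.edge y z ⟨r, hα⟩
      exact ⟨i, i.2.le, by rintro _ (rfl | rfl); exacts [hW' i _ hy, hW' i _ hz]⟩

/-- Logical consequences of a program are preserved by homomorphisms. -/
theorem Program.Entails.of_isHom {n : ℕ} {p : Program n} {𝒜 ℬ : ABox} {a : Fin n → Individual}
    (h : p.Entails 𝒜 a) {f : Individual → Individual} (hf : 𝒜.IsHom ℬ f) :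
    p.Entails ℬ fun i => f (a i) := by
  intro D _ M ι hA hM
  refine h D M (fun y => ι (f y)) (fun α hα => ?_) hM
  cases α with
  | concept A y => exact hA _ (hf.1 _ _ hα)
  | role r y z => exact hA _ (hf.2 _ _ _ hα)

theorem OMQ.PathwidthAtMost.isRewriting {Q : OMQ} {B k : ℕ} (hB : Q.Below B)
    (hk : Q.PathwidthAtMost k) :
    Q.IsRewriting (canonicalProgram Q.tbox Q.query B (k + Q.query.arity) Q.sig) := by
  refine ⟨canonicalProgram_over, fun 𝒜 a hS ha => ⟨fun h => ?_, canonicalProgram_sound ha⟩⟩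
  obtain ⟨𝒜', hS', hpw, h', f, hf, hfa⟩ := hk 𝒜 a hS h
  have := (canonicalProgram_complete hB hS' h' hpw).of_isHom hf
  simpa only [hfa] using this

/-! ### Unravelling derivations of linear programs -/

/-- `f` applied to the individuals of an assertion. -/
def Assertion.rename (f : Individual → Individual) : Assertion → Assertion
  | .concept A a => .concept A (f a)
  | .role r a b => .role r (f a) (f b)

theorem Assertion.inds_rename (f : Individual → Individual) (α : Assertion) :
    (α.rename f).inds = f '' α.inds := by
  cases α <;> simp [Assertion.rename, Assertion.inds, Set.image_pair]

/-- The ABox `ℬ` with path decomposition `W 0, …, W n` into bags of size at most `k + 1` maps to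
`𝒜` via `h`, and the last bag contains the individuals `a`, which are fixed by `h`. -/
structure IsUnravelling {m : ℕ} (𝒜 : ABox) (a : Fin m → Individual) (k : ℕ) (ℬ : ABox)
    (h : Individual → Individual) (n : ℕ) (W : ℕ → Finset Individual) : Prop where
  map_mem : ∀ α ∈ ℬ, α.rename h ∈ 𝒜
  map_ans : ∀ i, h (a i) = a i
  ans_mem : ∀ i, a i ∈ W n
  card_le : ∀ j ≤ n, (W j).card ≤ k + 1
  cover : ∀ α ∈ ℬ, ∃ j ≤ n, ∀ y ∈ α.inds, y ∈ W j
  convex : ∀ i j l, i ≤ j → j ≤ l → l ≤ n → ∀ y, y ∈ W i → y ∈ W l → y ∈ W j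

/-- `g` is a section of `h` with values in `V` on `X`, and fixes `a`. -/
structure IsSectionOn {m : ℕ} (a : Fin m → Individual) (h g : Individual → Individual)
    (V : Finset Individual) (X : Finset Individual) : Prop where
  fix : ∀ i, g (a i) = a i
  map_section : ∀ x ∈ X, h (g x) = x
  mem_bag : ∀ x ∈ X, g x ∈ V

section

variable {m : ℕ} {𝒜 : ABox} {a : Fin m → Individual} {k : ℕ}

theorem IsUnravelling.nil (hk : m ≤ k + 1) :
    IsUnravelling 𝒜 a k ∅ id 0 fun _ => Finset.univ.image a where
  map_mem := by simp
  map_ans _ := rfl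
  ans_mem i := Finset.mem_image_of_mem _ (Finset.mem_univ i)
  card_le _ _ := Finset.card_image_le.trans (by simpa using hk)
  cover := by simp
  convex _ _ _ _ _ _ _ h _ := h

theorem isSectionOn_empty (h : Individual → Individual) (V : Finset Individual) :
    IsSectionOn a h id V ∅ := ⟨fun _ => rfl, by simp, by simp⟩

/-- An unravelling can be extended by one bag that is a copy of a set `Y` of individuals of `𝒜`
with all assertions on `Y`. Individuals from `X` or `a` keep their copies `g x` in the last bag, and
the others get fresh copies. -/
theorem IsUnravelling.extend {ℬ : ABox} {h : Individual → Individual} {n : ℕ}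
    {W : ℕ → Finset Individual} (hU : IsUnravelling 𝒜 a k ℬ h n W) {g : Individual → Individual}
    {X : Finset Individual} (hg : IsSectionOn a h g (W n) X) (Y : Finset Individual)
    (hY : Y.card + m ≤ k + 1) :
    ∃ (ℬ' : ABox) (h' : Individual → Individual) (n' : ℕ) (W' : ℕ → Finset Individual)
      (g' : Individual → Individual), IsUnravelling 𝒜 a k ℬ' h' n' W' ∧
        IsSectionOn a h' g' (W' n') Y ∧ ℬ ⊆ ℬ' ∧ (∀ x ∈ X, g' x = g x) ∧
        ∀ α ∈ 𝒜, (∀ y ∈ α.inds, y ∈ Y) → α.rename g' ∈ ℬ' := by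
  classical
  let R : Finset Individual := Finset.univ.image a
  have hRa : ∀ i, a i ∈ R := fun i => Finset.mem_image_of_mem _ (Finset.mem_univ i)
  have hR : ∀ x ∈ R, g x = x ∧ h x = x ∧ x ∈ W n := by
    intro x hx
    obtain ⟨i, -, rfl⟩ := Finset.mem_image.1 hx
    exact ⟨hg.fix i, hU.map_ans i, hU.ans_mem i⟩
  -- all individuals used so far are smaller than `N`
  obtain ⟨N, hN⟩ : ∃ N, ∀ j ≤ n, ∀ y ∈ W j, y < N := by
    refine ⟨((Finset.range (n + 1)).biUnion W).sup id + 1, fun j hj y hy => ?_⟩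
    exact Nat.lt_succ_of_le (Finset.le_sup (f := id) (Finset.mem_biUnion.2
      ⟨j, Finset.mem_range.2 (Nat.lt_succ_of_le hj), hy⟩))
  let g' : Individual → Individual := fun x => if x ∈ X ∪ R then g x else N + x
  let h' : Individual → Individual := fun y => if y < N then h y else y - N
  let W' : ℕ → Finset Individual := fun j => if j ≤ n then W j else (Y ∪ R).image g'
  have hold : ∀ x ∈ X ∪ R, g' x = g x ∧ h (g x) = x ∧ g x ∈ W n := by
    intro x hx
    refine ⟨if_pos hx, ?_⟩
    rcases Finset.mem_union.1 hx with hx | hx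
    · exact ⟨hg.map_section x hx, hg.mem_bag x hx⟩
    · obtain ⟨h1, h2, h3⟩ := hR x hx
      rw [h1]
      exact ⟨h2, h3⟩
  have hnew : ∀ x, x ∉ X ∪ R → g' x = N + x := fun x hx => if_neg hx
  have hh' : ∀ x, h' (g' x) = x := by
    intro x
    by_cases hx : x ∈ X ∪ R
    · obtain ⟨h1, h2, h3⟩ := hold x hx
      rw [h1]
      exact (if_pos (hN n le_rfl _ h3)).trans h2
    · rw [hnew x hx]
      simp [h']
  have hhW : ∀ j ≤ n, ∀ y ∈ W j, h' y = h y := fun j hj y hy => if_pos (hN j hj y hy)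
  have hW : ∀ j ≤ n, W' j = W j := fun j hj => if_pos hj
  have hWn : W' (n + 1) = (Y ∪ R).image g' := if_neg (by omega)
  have hg'a : ∀ i, g' (a i) = a i := fun i =>
    (hold _ (Finset.mem_union_right _ (hRa i))).1.trans (hg.fix i)
  refine ⟨ℬ ∪ (𝒜.filter fun α => ∀ y ∈ α.inds, y ∈ Y).image (Assertion.rename g'), h', n + 1, W',
    g', ⟨?_, ?_, ?_, ?_, ?_, ?_⟩, ⟨hg'a, fun x _ => hh' x, ?_⟩, Finset.subset_union_left, ?_, ?_⟩
  · intro α hα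
    rcases Finset.mem_union.1 hα with hα | hα
    · obtain ⟨j, hj, hjα⟩ := hU.cover α hα
      have := hU.map_mem α hα
      cases α with
      | concept A y =>
        simpa only [Assertion.rename, hhW j hj y (hjα y rfl)] using this
      | role r y z =>
        simpa only [Assertion.rename, hhW j hj y (hjα y (.inl rfl)),
          hhW j hj z (hjα z (.inr rfl))] using this
    · obtain ⟨β, hβ, rfl⟩ := Finset.mem_image.1 hα
      have hβ := (Finset.mem_filter.1 hβ).1
      cases β <;> simpa only [Assertion.rename, hh'] using hβ
  · intro i
    rw [hhW n le_rfl _ (hU.ans_mem i)]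
    exact hU.map_ans i
  · intro i
    rw [hWn]
    exact Finset.mem_image.2 ⟨a i, Finset.mem_union_right _ (hRa i), hg'a i⟩
  · intro j hj
    rcases Nat.lt_or_ge n j with hnj | hnj
    · obtain rfl : j = n + 1 := by omega
      rw [hWn]
      have h1 : R.card ≤ m := Finset.card_image_le.trans (by simp)
      have h2 := Finset.card_union_le Y R
      exact Finset.card_image_le.trans (by omega)
    · rw [hW j hnj]
      exact hU.card_le j hnj
  · intro α hα
    rcases Finset.mem_union.1 hα with hα | hα
    · obtain ⟨j, hj, hjα⟩ := hU.cover α hα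
      exact ⟨j, by omega, by rwa [hW j hj]⟩
    · obtain ⟨β, hβ, rfl⟩ := Finset.mem_image.1 hα
      refine ⟨n + 1, le_rfl, ?_⟩
      rw [hWn, Assertion.inds_rename]
      rintro _ ⟨y, hy, rfl⟩
      exact Finset.mem_image_of_mem _
        (Finset.mem_union_left _ ((Finset.mem_filter.1 hβ).2 y hy))
  · intro i j l hij hjl hl y hyi hyl
    rcases Nat.lt_or_ge n l with hnl | hnl
    · obtain rfl : l = n + 1 := by omega
      rcases Nat.lt_or_ge n j with hnj | hnj
      · obtain rfl : j = n + 1 := by omega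
        exact hyl
      · rw [hW i (hij.trans hnj)] at hyi
        rw [hWn] at hyl
        rw [hW j hnj]
        -- an individual of the new bag that is not fresh is in the bag `W n`
        refine hU.convex i j n hij hnj le_rfl y hyi ?_
        obtain ⟨x, -, rfl⟩ := Finset.mem_image.1 hyl
        by_cases hx : x ∈ X ∪ R
        · obtain ⟨h1, -, h3⟩ := hold x hx
          rwa [h1]
        · have := hN i (hij.trans hnj) _ hyi
          rw [hnew x hx] at this
          exact absurd this (Nat.not_lt.2 (Nat.le_add_right N x))
    · rw [hW _ hnl] at hyl
      rw [hW _ (hjl.trans hnl)]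
      rw [hW _ (hij.trans (hjl.trans hnl))] at hyi
      exact hU.convex i j l hij hjl hnl y hyi hyl
  · intro x hx
    rw [hWn]
    exact Finset.mem_image_of_mem _ (Finset.mem_union_left _ hx)
  · exact fun x hx => (hold x (Finset.mem_union_left _ hx)).1
  · intro α hα hαY
    exact Finset.mem_union_right _
      (Finset.mem_image_of_mem _ (Finset.mem_filter.2 ⟨hα, hαY⟩))

theorem IsUnravelling.isHom {ℬ : ABox} {h : Individual → Individual} {n : ℕ}
    {W : ℕ → Finset Individual} (hU : IsUnravelling 𝒜 a k ℬ h n W) : ℬ.IsHom 𝒜 h :=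
  ⟨fun _ _ hα => hU.map_mem _ hα, fun _ _ _ hα => hU.map_mem _ hα⟩

theorem IsUnravelling.over {ℬ : ABox} {h : Individual → Individual} {n : ℕ}
    {W : ℕ → Finset Individual} (hU : IsUnravelling 𝒜 a k ℬ h n W) {S : Signature}
    (hS : 𝒜.Over S) : ℬ.Over S := by
  intro α hα
  have := hS _ (hU.map_mem α hα)
  cases α <;> exact this

theorem IsUnravelling.pathwidth_le {ℬ : ABox} {h : Individual → Individual} {n : ℕ}
    {W : ℕ → Finset Individual} (hU : IsUnravelling 𝒜 a k ℬ h n W) : ℬ.pathwidth ≤ k := by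
  classical
  -- the bags may contain answer individuals that do not occur in `ℬ`
  refine Nat.sInf_le ⟨n + 1, fun j => (W j).filter (· ∈ ℬ.ind), ⟨?_, ?_, ?_, ?_⟩, ?_⟩
  · intro i x hx
    exact (Finset.mem_filter.1 hx).2
  · rintro x ⟨α, hα, hx⟩
    obtain ⟨j, hj, hjα⟩ := hU.cover α hα
    exact ⟨⟨j, by omega⟩, Finset.mem_filter.2 ⟨hjα x hx, α, hα, hx⟩⟩
  · rintro x y ⟨r, hr⟩
    obtain ⟨j, hj, hjα⟩ := hU.cover _ hr
    exact ⟨⟨j, by omega⟩, Finset.mem_filter.2 ⟨hjα x (.inl rfl), _, hr, .inl rfl⟩,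
      Finset.mem_filter.2 ⟨hjα y (.inr rfl), _, hr, .inr rfl⟩⟩
  · intro i j l hij hjl x hx hx'
    rw [Finset.mem_filter] at hx hx' ⊢
    exact ⟨hU.convex i j l hij hjl (by omega) x hx.1 hx'.1, hx.2⟩
  · intro j
    exact (Finset.card_filter_le _ _).trans (hU.card_le j (by omega))

end

theorem BodyAtom.vars_finite (α : BodyAtom) : α.vars.Finite := by
  cases α with
  | concept | role | top => simp [BodyAtom.vars]
  | idb P xs => exact List.finite_toSet xs

/-- The variables in the body of a rule. -/
noncomputable def Rule.vars {n : ℕ} (ρ : Rule n) : Finset ℕ :=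
  (Set.Finite.biUnion (List.finite_toSet ρ.body) fun α _ => α.vars_finite).toFinset

theorem Rule.mem_vars {n : ℕ} {ρ : Rule n} {x : ℕ} :
    x ∈ ρ.vars ↔ ∃ α ∈ ρ.body, x ∈ α.vars := by
  simp [Rule.vars]

theorem eq_of_countP_le_one {α : Type*} {p : α → Bool} {l : List α} (h : l.countP p ≤ 1)
    {x y : α} (hx : x ∈ l) (hy : y ∈ l) (hpx : p x) (hpy : p y) : x = y := by
  have hx' : x ∈ l.filter p := List.mem_filter.2 ⟨hx, hpx⟩
  have hy' : y ∈ l.filter p := List.mem_filter.2 ⟨hy, hpy⟩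
  rw [List.countP_eq_length_filter] at h
  match hl : l.filter p, h, hx', hy' with
  | [z], _, hx', hy' => rw [List.mem_singleton.1 hx', List.mem_singleton.1 hy']
  | [], _, hx', _ => simp at hx'

section

variable {m : ℕ} (p : Program m) (𝒜 : ABox) (a : Fin m → Individual) (k : ℕ)

/-- Some unravelling of `𝒜` entails a copy of the fact, with individuals from its last bag. The
fact is encoded as a head atom whose variables, natural numbers as well, are read as individuals. -/
def DerivedByUnravelling (fact : HeadAtom m) : Prop :=
  ∃ (ℬ : ABox) (h : Individual → Individual) (n : ℕ) (W : ℕ → Finset Individual)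
    (g : Individual → Individual) (X : Finset Individual), IsUnravelling 𝒜 a k ℬ h n W ∧
      IsSectionOn a h g (W n) X ∧ fact.vars ⊆ X ∧
      ∀ (D : Type) [Nonempty D] (M : DStruct m D) (ι : Individual → D),
        M.ModelsABox ι ℬ → M.ModelsProgram p → M.SatHead (fun x => ι (g x)) fact

/-- The structure of the EDB facts of `𝒜` and of the IDB facts that unravellings derive. -/
def unravellingStruct : DStruct m Individual where
  concept A := {y | Assertion.concept A y ∈ 𝒜}
  role r y z := Assertion.role r y z ∈ 𝒜
  idb P ys := DerivedByUnravelling p 𝒜 a k (.idb P ys)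
  goal d := DerivedByUnravelling p 𝒜 a k (.goal d)

variable {p 𝒜 a k}

/-- A rule of a linear program extends the unravelling for its only IDB atom by one bag, which is a
copy of the image of its variables. -/
theorem unravellingStruct_modelsProgram (hp : p.IsLinear)
    (hk : ∀ ρ ∈ p.rules, ρ.vars.card + m ≤ k + 1) (hmk : m ≤ k + 1) :
    (unravellingStruct p 𝒜 a k).ModelsProgram p := by
  classical
  intro ρ hρ σ hbody
  -- an unravelling that takes care of the IDB atoms of the body
  obtain ⟨ℬ, h, n, W, g, X, hU, hg, hX⟩ : ∃ (ℬ : ABox) (h : Individual → Individual) (n : ℕ)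
      (W : ℕ → Finset Individual) (g : Individual → Individual) (X : Finset Individual),
      IsUnravelling 𝒜 a k ℬ h n W ∧ IsSectionOn a h g (W n) X ∧
      ∀ P xs, BodyAtom.idb P xs ∈ ρ.body → (∀ x ∈ xs, σ x ∈ X) ∧
        ∀ (D : Type) [Nonempty D] (M : DStruct m D) (ι : Individual → D),
          M.ModelsABox ι ℬ → M.ModelsProgram p → M.idb P (xs.map fun x => ι (g (σ x))) := by
    by_cases hidb : ∃ P xs, BodyAtom.idb P xs ∈ ρ.body
    · obtain ⟨P, xs, hP⟩ := hidb
      obtain ⟨ℬ, h, n, W, g, X, hU, hg, hX, hD⟩ := hbody _ hP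
      refine ⟨ℬ, h, n, W, g, X, hU, hg, fun P' xs' hP' => ?_⟩
      cases eq_of_countP_le_one (hp ρ hρ) hP hP' rfl rfl
      refine ⟨fun x hx => hX (List.mem_map_of_mem hx), fun D _ M ι hA hM => ?_⟩
      simpa [DStruct.SatHead, Function.comp_def] using hD D M ι hA hM
    · exact ⟨∅, id, 0, _, id, ∅, .nil hmk, isSectionOn_empty _ _,
        fun P xs h => absurd ⟨P, xs, h⟩ hidb⟩
  obtain ⟨ℬ', h', n', W', g', hU', hg', hsub, hgg, hcopy⟩ := hU.extend hg (ρ.vars.image σ)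
    ((Nat.add_le_add_right Finset.card_image_le _).trans (hk ρ hρ))
  have hY : ∀ α ∈ ρ.body, ∀ x ∈ α.vars, σ x ∈ ρ.vars.image σ := fun α hα x hx =>
    Finset.mem_image_of_mem _ (Rule.mem_vars.2 ⟨α, hα, hx⟩)
  have hfinal : ∀ (D : Type) [Nonempty D] (M : DStruct m D) (ι : Individual → D),
      M.ModelsABox ι ℬ' → M.ModelsProgram p → M.SatHead (fun x => ι (g' (σ x))) ρ.head := by
    intro D _ M ι hA hM
    refine hM ρ hρ _ fun α hα => ?_
    have hα' := hbody α hα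
    have hαY := hY α hα
    cases α with
    | concept A x =>
      refine hA _ (hcopy (.concept A (σ x)) hα' ?_)
      rintro _ rfl
      exact hαY x rfl
    | role r x y =>
      refine hA _ (hcopy (.role r (σ x) (σ y)) hα' ?_)
      rintro _ (rfl | rfl)
      exacts [hαY x (.inl rfl), hαY y (.inr rfl)]
    | top x => trivial
    | idb P xs =>
      obtain ⟨h1, h2⟩ := hX P xs hα
      have := h2 D M ι (fun β hβ => hA β (hsub hβ)) hM
      have heq : (xs.map fun x => ι (g' (σ x))) = xs.map fun x => ι (g (σ x)) :=
        List.map_congr_left fun x hx => by rw [hgg _ (h1 x hx)]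
      simpa only [DStruct.SatBody, List.map_map, Function.comp_def, heq] using this
  have hhead : ∀ x ∈ ρ.head.vars, σ x ∈ ρ.vars.image σ := by
    intro x hx
    obtain ⟨α, hα, hxα⟩ := ρ.safe x hx
    exact hY α hα x hxα
  cases hh : ρ.head with
  | idb P xs =>
    rw [hh] at hfinal hhead
    refine ⟨ℬ', h', n', W', g', _, hU', hg', ?_, fun D _ M ι hA hM => ?_⟩
    · intro y hy
      obtain ⟨x, hx, rfl⟩ := List.mem_map.1 hy
      exact hhead x hx
    · simpa [DStruct.SatHead, Function.comp_def] using hfinal D M ι hA hM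
  | goal xs =>
    rw [hh] at hfinal hhead
    refine ⟨ℬ', h', n', W', g', _, hU', hg', ?_, fun D _ M ι hA hM => hfinal D M ι hA hM⟩
    rintro _ ⟨i, rfl⟩
    exact hhead _ ⟨i, rfl⟩

end

theorem OMQ.LinearDatalogRewritable.boundedPathwidth {Q : OMQ} (hQ : Q.LinearDatalogRewritable) :
    Q.BoundedPathwidth := by
  classical
  obtain ⟨p, hp, -, hrew⟩ := hQ
  let k := p.rules.sup (fun ρ => ρ.vars.card) + 3 * Q.query.arity
  refine ⟨k, fun 𝒜 a hS h => ?_⟩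
  have hgoal := (hrew 𝒜 a hS h.1).1 h Individual (unravellingStruct p 𝒜 a k) id
    (fun α hα => by cases α <;> exact hα)
    (unravellingStruct_modelsProgram hp (fun ρ hρ => by
      have : ρ.vars.card ≤ p.rules.sup (fun ρ => ρ.vars.card) :=
        Finset.le_sup (f := fun ρ => ρ.vars.card) hρ
      omega) (by omega))
  obtain ⟨ℬ, g, n, W, s, X, hU, hs, hX, hD⟩ := hgoal
  -- one more bag for assertions of `𝒜` that contain the answer individuals
  have hb : ∀ i, ∃ b, ∃ α ∈ 𝒜, a i ∈ α.inds ∧ ∀ y ∈ α.inds, y = a i ∨ y = b := by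
    intro i
    obtain ⟨α, hα, hi⟩ := h.1 i
    cases α with
    | concept A y => exact ⟨y, _, hα, hi, fun z hz => .inr hz⟩
    | role r y z =>
      rcases hi with hi | hi
      · exact ⟨z, _, hα, .inl hi, by rintro w (rfl | rfl); exacts [.inl hi.symm, .inr rfl]⟩
      · exact ⟨y, _, hα, .inr hi, by rintro w (rfl | rfl); exacts [.inr rfl, .inl hi.symm]⟩
  choose b α hα hi hαb using hb
  obtain ⟨ℬ', g', n', W', s', hU', hs', hsub, hss, hcopy⟩ := hU.extend hs
    (Finset.univ.image a ∪ Finset.univ.image b) (by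
      have h1 : (Finset.univ.image a).card ≤ Q.query.arity := Finset.card_image_le.trans (by simp)
      have h2 : (Finset.univ.image b).card ≤ Q.query.arity := Finset.card_image_le.trans (by simp)
      have := Finset.card_union_le (Finset.univ.image a) (Finset.univ.image b)
      omega)
  have hind : ∀ i, a i ∈ ABox.ind ℬ' := by
    intro i
    refine ⟨_, hcopy (α i) (hα i) fun y hy => ?_, ?_⟩
    · rcases hαb i y hy with rfl | rfl
      · exact Finset.mem_union_left _ (Finset.mem_image_of_mem _ (Finset.mem_univ i))
      · exact Finset.mem_union_right _ (Finset.mem_image_of_mem _ (Finset.mem_univ i))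
    · rw [Assertion.inds_rename]
      exact ⟨a i, hi i, hs'.fix i⟩
  refine ⟨ℬ', hU'.over hS, hU'.pathwidth_le, ?_, g', hU'.isHom, hU'.map_ans⟩
  refine (hrew ℬ' a (hU'.over hS) hind).2 fun D _ M ι hA hM => ?_
  have := hD D M ι (fun β hβ => hA β (hsub hβ)) hM
  simpa [DStruct.SatHead, hs.fix] using this

end ELI

theorem lemma4p10 (Q : ELI.OMQ) :
    (Q.BoundedPathwidth ↔ Q.LinearDatalogRewritable) ∧
    (Q.BoundedPathwidth →
      ∃ p : ELI.Program Q.query.arity,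
        p.IsLinear ∧ Q.IsRewriting p ∧ p.width = Q.pathwidth + Q.query.arity) := by
  have key : Q.BoundedPathwidth → ∃ p : ELI.Program Q.query.arity,
      p.IsLinear ∧ Q.IsRewriting p ∧ p.width = Q.pathwidth + Q.query.arity := by
    intro h
    obtain ⟨B, hB⟩ := Q.exists_below
    have hk : Q.PathwidthAtMost Q.pathwidth := Nat.sInf_mem h
    exact ⟨_, ELI.canonicalProgram_isLinear, hk.isRewriting hB, ELI.canonicalProgram_width⟩
  refine ⟨⟨fun h => ?_, fun h => h.boundedPathwidth⟩, key⟩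
  obtain ⟨p, hp, hr, -⟩ := key h
  exact ⟨p, hp, hr⟩
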